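/- **Setting.** Let $\eta\in\mathbb R\setminus\{0\}$ and $q=e^{-\eta/2}$. $U_q=U_q[osp(1|2)]$ is the $\mathbb Z_2$-graded Hopf algebra over $\mathbb C$ generated by the even element $H$ (together with $q^{\pm H}$) and the odd elements $v_\pm$, with $$[H,v_\pm]=\pm\tfrac12 v_\pm,\qquad v_+v_-+v_-v_+=-\frac{\sinh(\eta H)}{\sinh(2\eta)},$$ coproduct $\Delta(H)=H\otimes1+1\otimes H$, $\Delta(v_\pm)=v_\pm\otimes q^H+q^{-H}\otimes v_\pm$ (a homomorphism for the product $(a\otimes b)(c\otimes d)=(-1)^{|b||c|}ac\otimes bd$), and antipode $S(H)=-H$, $S(v_\pm)=-q^{\pm1/2}v_\pm$, $S(ab)=(-1)^{|a||b|}S(b)S(a)$. Write $\Delta(a)=\sum a_1\otimes a_2$. For $l\in\mathbb Z_{\ge0}$ and $\lambda\in\mathbb Z_2$ let $V^l(\lambda)$ be the irreducible graded representation with basis $e^l_m(\lambda)$, $-l\le m\le l$, of parity $|e^l_m(\lambda)|=l-m+\lambda \bmod 2$ and action $$H e_m=\tfrac m2e_m,\quad v_+e_m=(-1)^{l-m}\sqrt{[l-m][l+m+1]\gamma}\;e_{m+1},\quad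 v_-e_m=\sqrt{[l+m][l-m+1]\gamma}\;e_{m-1},$$ where $[n]=\dfrac{q^{-n/2}-(-1)^nq^{n/2}}{q^{-1/2}+q^{1/2}}$ and $\gamma=\dfrac{\cosh(\eta/4)}{\sinh(2\eta)}$. For graded representations $(V,\pi)$, $(W,\rho)$, the space $V\otimes W$ carries the action $a(v\otimes w)=\sum(-1)^{|a_2||v|}\pi(a_1)v\otimes\rho(a_2)w$, and $\mathrm{Hom}(V,W)$ the action $\delta(a)f=\sum(-1)^{|a_2||f|}\rho(a_1)\circ f\circ\pi(S(a_2))$. A linear map $f:V\to W$ homogeneous of degree $|f|$ is a graded intertwiner if $f\circ\pi(a)=(-1)^{|a||f|}\rho(a)\circ f$ for all homogeneous $a\in U_q$; the space of graded intertwiners is the sum of the even and of the odd ones. The Clebsch–Gordan coefficients $(l_1m_1\lambda_1,l_2m_2\lambda_2|lm\lambda)_q$ are the real coefficients in $$e^l_m(l_1,l_2,\lambda)=\sum_{m_1,m_2}(l_1m_1\lambda_1,l_2m_2\lambda_2|lm\lambda)_q\,e^{l_1}_{m_1}(\lambda_1)\otimes e^{l_2}_{m_2}(\lambda_2)$$ of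 the standard basis of the component $V^l(\lambda)$ of $V^{l_1}(\lambda_1)\otimes V^{l_2}(\lambda_2)$, i.e. $e^l_m(\lambda)\mapsto e^l_m(l_1,l_2,\lambda)$ is an even homomorphism of representations, normalized by $\sum_{m_1,m_2}(-1)^{(l_1-m_1)(l_2-m_2)}(l_1m_1\lambda_1,l_2m_2\lambda_2|ll\lambda)_q^2=1$ and $(l_1l_1\lambda_1,l_2\,l{-}l_1\,\lambda_2|ll\lambda)_q>0$; they are zero if $V^l(\lambda)$ does not occur. The component $V^l(\lambda)$ occurs exactly when $|l_1-l_2|\le l\le l_1+l_2$ and $\lambda=\lambda_1+\lambda_2+l_1+l_2+l \bmod 2$. The modified coefficients are, with $L=l_1+l_2+l$, $$[l_1m_1\lambda_1,l_2m_2\lambda_2|lm\lambda]_q=(-1)^{(l_1-m_1)(l_2-m_2)}(-1)^{(l-m)L}(l_1m_1\lambda_1,l_2m_2\lambda_2|lm\lambda)_q .$$ **Theorem 1 (Wigner–Eckart theorem for $U_q[osp(1|2)]$).** Let $l_1,l_2,l_3\in\mathbb Z_{\ge0}$ and $\lambda_1,\lambda_2,\lambda_3\in\mathbb Z_2$ with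 $\lambda_3=\lambda_1+\lambda_2+l_1+l_2+l_3 \bmod 2$, and let $T$ be an irreducible tensor operator, i.e. a graded intertwiner from $V^{l_1}(\lambda_1)$ to $\mathrm{Hom}(V^{l_2}(\lambda_2),V^{l_3}(\lambda_3))$. Then: 1. there is a number $\alpha\in\mathbb C$ (the reduced matrix element), independent of $m_1,m_2,m_3$, such that for all $m_1,m_2,m_3$ the matrix elements defined by $T(e^{l_1}_{m_1}(\lambda_1))\,e^{l_2}_{m_2}(\lambda_2)=\sum_{m_3}[T(e^{l_1}_{m_1}(\lambda_1))]_{m_3m_2}\,e^{l_3}_{m_3}(\lambda_3)$ satisfy $$[T(e^{l_1}_{m_1}(\lambda_1))]_{m_3m_2}=\alpha\,[l_1m_1\lambda_1,l_2m_2\lambda_2|l_3m_3\lambda_3]_q;$$ 2. $T$ is even, i.e. $T$ is a homomorphism of representations. -/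

import Mathlib

open scoped TensorProduct DirectSum

noncomputable section

namespace QuantumOsp

/-! ### Signs and gradings by `ℤ/2` -/

/-- The sign `(-1)^i` for `i ∈ ℤ/2`. -/
def sgn (i : ZMod 2) : ℂ := if i = 0 then 1 else -1

@[simp] theorem sgn_zero : sgn 0 = 1 := by simp [sgn]

@[simp] theorem sgn_one : sgn 1 = -1 := by simp [sgn]

theorem zmod2_cases (i : ZMod 2) : i = 0 ∨ i = 1 := by
  revert i; decide

theorem sgn_mul_self (i : ZMod 2) : sgn i * sgn i = 1 := by
  rcases zmod2_cases i with rfl | rfl <;> simp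

theorem sgn_add (i j : ZMod 2) : sgn (i + j) = sgn i * sgn j := by
  rcases zmod2_cases i with rfl | rfl <;> rcases zmod2_cases j with rfl | rfl <;>
    simp [show (1 + 1 : ZMod 2) = 0 from by decide]

/-! ### The quantum superalgebra -/

/-- Generators: `H`, `v₊`, `v₋`, and the exponentials `K = q^H`, `Kinv = q^{-H}`. -/
inductive Gen
  | H | vp | vm | K | Kinv

/-- `q = e^{-η/2}`. -/
def qpar (η : ℝ) : ℝ := Real.exp (-η / 2)

/-- `q^x` for real `x`. -/
def qpow (η x : ℝ) : ℝ := qpar η ^ x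

/-- A generator as an element of the free algebra. -/
abbrev gen (g : Gen) : FreeAlgebra ℂ Gen := FreeAlgebra.ι ℂ g

/-- The defining relations.  Since `q = e^{-η/2}`, one has `K² = q^{2H} = e^{-ηH}`, so that
`-sinh(ηH)/sinh(2η) = (K² - K⁻²)/(2 sinh(2η))`. -/
inductive Rel (η : ℝ) : FreeAlgebra ℂ Gen → FreeAlgebra ℂ Gen → Prop
  | K_Kinv : Rel η (gen .K * gen .Kinv) 1
  | Kinv_K : Rel η (gen .Kinv * gen .K) 1
  | H_K : Rel η (gen .H * gen .K) (gen .K * gen .H)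
  | H_vp : Rel η (gen .H * gen .vp) (gen .vp * gen .H + (1 / 2 : ℂ) • gen .vp)
  | H_vm : Rel η (gen .H * gen .vm) (gen .vm * gen .H - (1 / 2 : ℂ) • gen .vm)
  | K_vp : Rel η (gen .K * gen .vp) ((qpow η (1 / 2) : ℂ) • (gen .vp * gen .K))
  | K_vm : Rel η (gen .K * gen .vm) ((qpow η (-1 / 2) : ℂ) • (gen .vm * gen .K))
  | vp_vm : Rel η (gen .vp * gen .vm + gen .vm * gen .vp)
      ((1 / (2 * Real.sinh (2 * η)) : ℂ) • (gen .K * gen .K - gen .Kinv * gen .Kinv))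

/-- The quantum superalgebra `U_q[osp(1|2)]`. -/
def Uq (η : ℝ) : Type := RingQuot (Rel η)

instance (η : ℝ) : Ring (Uq η) := inferInstanceAs (Ring (RingQuot (Rel η)))

instance (η : ℝ) : Algebra ℂ (Uq η) := inferInstanceAs (Algebra ℂ (RingQuot (Rel η)))

/-- The quotient map from the free algebra. -/
def mkUq (η : ℝ) : FreeAlgebra ℂ Gen →ₐ[ℂ] Uq η := RingQuot.mkAlgHom ℂ (Rel η)

theorem mkUq_rel {η : ℝ} {x y : FreeAlgebra ℂ Gen} (h : Rel η x y) : mkUq η x = mkUq η y :=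
  RingQuot.mkAlgHom_rel ℂ h

/-- A generator as an element of `U_q[osp(1|2)]`. -/
def ug (η : ℝ) (g : Gen) : Uq η := mkUq η (gen g)

/-- A choice of images of the generators that satisfies the defining relations. -/
structure Realizes (η : ℝ) {B : Type*} [Ring B] [Algebra ℂ B] (x : Gen → B) : Prop where
  K_Kinv : x .K * x .Kinv = 1
  Kinv_K : x .Kinv * x .K = 1
  H_K : x .H * x .K = x .K * x .H
  H_vp : x .H * x .vp = x .vp * x .H + (1 / 2 : ℂ) • x .vp
  H_vm : x .H * x .vm = x .vm * x .H - (1 / 2 : ℂ) • x .vm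
  K_vp : x .K * x .vp = (qpow η (1 / 2) : ℂ) • (x .vp * x .K)
  K_vm : x .K * x .vm = (qpow η (-1 / 2) : ℂ) • (x .vm * x .K)
  vp_vm : x .vp * x .vm + x .vm * x .vp
      = (1 / (2 * Real.sinh (2 * η)) : ℂ) • (x .K * x .K - x .Kinv * x .Kinv)

theorem ug_realizes (η : ℝ) : Realizes η (ug η) := by
  constructor <;> simp only [ug, ← map_mul, ← map_add, ← map_sub, ← map_smul] <;>
    first
      | (rw [← map_one (mkUq η)]
         exact mkUq_rel (by constructor))
      | exact mkUq_rel (by constructor)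

/-- The universal property of `U_q[osp(1|2)]`. -/
def liftUq (η : ℝ) {B : Type*} [Ring B] [Algebra ℂ B] (x : Gen → B) (hx : Realizes η x) :
    Uq η →ₐ[ℂ] B :=
  RingQuot.liftAlgHom ℂ ⟨FreeAlgebra.lift ℂ x, by
    intro a b h
    cases h <;> simp only [map_mul, map_add, map_sub, map_smul, map_one, gen,
      FreeAlgebra.lift_ι_apply]
    · exact hx.K_Kinv
    · exact hx.Kinv_K
    · exact hx.H_K
    · exact hx.H_vp
    · exact hx.H_vm
    · exact hx.K_vp
    · exact hx.K_vm
    · exact hx.vp_vm⟩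

@[simp] theorem liftUq_ug (η : ℝ) {B : Type*} [Ring B] [Algebra ℂ B] (x : Gen → B)
    (hx : Realizes η x) (g : Gen) : liftUq η x hx (ug η g) = x g :=
  (RingQuot.liftAlgHom_mkAlgHom_apply _ _ _ _).trans (FreeAlgebra.lift_ι_apply _ _)

theorem Uq_hom_ext {η : ℝ} {B : Type*} [Ring B] [Algebra ℂ B] {f g : Uq η →ₐ[ℂ] B}
    (h : ∀ x, f (ug η x) = g (ug η x)) : f = g := by
  apply RingQuot.ringQuot_ext'
  apply FreeAlgebra.hom_ext
  funext x
  exact h x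

/-- The degrees of the generators. -/
def Gen.deg : Gen → ZMod 2
  | .vp => 1
  | .vm => 1
  | _ => 0

/-- The parity automorphism of `U_q[osp(1|2)]`: `+1` on the even part, `-1` on the odd part. -/
def parityAut (η : ℝ) : Uq η →ₐ[ℂ] Uq η :=
  liftUq η (fun g => sgn g.deg • ug η g) (by
    have h := ug_realizes η
    constructor <;> simp only [Gen.deg, sgn_zero, sgn_one, one_smul, neg_smul, mul_neg, neg_mul,
      neg_neg, smul_neg]
    · exact h.K_Kinv
    · exact h.Kinv_K
    · exact h.H_K
    · rw [h.H_vp]; abel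
    · rw [h.H_vm]; abel
    · rw [h.K_vp]
    · rw [h.K_vm]
    · exact h.vp_vm)

@[simp] theorem parityAut_ug (η : ℝ) (g : Gen) :
    parityAut η (ug η g) = sgn g.deg • ug η g := by
  simp [parityAut]

@[simp] theorem parityAut_parityAut (η : ℝ) (a : Uq η) : parityAut η (parityAut η a) = a := by
  have : (parityAut η).comp (parityAut η) = AlgHom.id ℂ (Uq η) := by
    apply Uq_hom_ext
    intro g
    simp [smul_smul, sgn_mul_self]
  exact DFunLike.congr_fun this a

/-- The `ℤ/2`-grading of `U_q[osp(1|2)]`. -/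
def grading (η : ℝ) (i : ZMod 2) : Submodule ℂ (Uq η) :=
  Module.End.eigenspace (parityAut η).toLinearMap (sgn i)

theorem mem_grading {η : ℝ} {i : ZMod 2} {a : Uq η} :
    a ∈ grading η i ↔ parityAut η a = sgn i • a := by
  simp [grading]

theorem ug_mem (η : ℝ) (g : Gen) : ug η g ∈ grading η g.deg := by
  simp [mem_grading]

/-- The component of degree `i` of an element of `U_q[osp(1|2)]`. -/
def comp (η : ℝ) (i : ZMod 2) : Uq η →ₗ[ℂ] Uq η :=
  (1 / 2 : ℂ) • (LinearMap.id + sgn i • (parityAut η).toLinearMap)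

theorem comp_apply (η : ℝ) (i : ZMod 2) (a : Uq η) :
    comp η i a = (1 / 2 : ℂ) • (a + sgn i • parityAut η a) := rfl

theorem comp_mem (η : ℝ) (i : ZMod 2) (a : Uq η) : comp η i a ∈ grading η i := by
  rw [mem_grading, comp_apply]
  simp only [map_smul, map_add, parityAut_parityAut, smul_add, smul_smul]
  rw [add_comm]
  congr 2
  · ring
  · linear_combination (-1 / 2 : ℂ) * sgn_mul_self i

theorem comp_add (η : ℝ) (a : Uq η) : comp η 0 a + comp η 1 a = a := by
  simp only [comp_apply, sgn_zero, sgn_one]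
  module

theorem comp_of_mem {η : ℝ} {i : ZMod 2} {a : Uq η} (h : a ∈ grading η i) (j : ZMod 2) :
    comp η j a = if j = i then a else 0 := by
  rw [mem_grading] at h
  rw [comp_apply, h]
  rcases zmod2_cases i with rfl | rfl <;> rcases zmod2_cases j with rfl | rfl <;>
    simp <;> module

instance (η : ℝ) : SetLike.GradedMonoid (grading η) where
  one_mem := by simp [mem_grading]
  mul_mem i j a b ha hb := by
    rw [mem_grading] at *
    rw [map_mul, ha, hb, sgn_add, smul_mul_smul_comm]

instance (η : ℝ) : DirectSum.Decomposition (grading η) :=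
  DirectSum.Decomposition.ofLinearMap (grading η)
    (DirectSum.lof ℂ (ZMod 2) (fun i => grading η i) 0 ∘ₗ
        (comp η 0).codRestrict (grading η 0) (comp_mem η 0)
      + DirectSum.lof ℂ (ZMod 2) (fun i => grading η i) 1 ∘ₗ
        (comp η 1).codRestrict (grading η 1) (comp_mem η 1))
    (by
      ext a
      simp [comp_add])
    (by
      apply DirectSum.linearMap_ext
      intro i
      apply LinearMap.ext
      intro a
      have h0 : (comp η 0).codRestrict (grading η 0) (comp_mem η 0) a
          = if h : i = 0 then h ▸ a else 0 := by
        apply Subtype.ext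
        rcases zmod2_cases i with rfl | rfl <;> simp [comp_of_mem a.2]
      have h1 : (comp η 1).codRestrict (grading η 1) (comp_mem η 1) a
          = if h : i = 1 then h ▸ a else 0 := by
        apply Subtype.ext
        rcases zmod2_cases i with rfl | rfl <;> simp [comp_of_mem a.2]
      rcases zmod2_cases i with rfl | rfl <;> simp [h0, h1])

instance (η : ℝ) : GradedAlgebra (grading η) where

theorem units_smul_eq_sgn {M : Type*} [AddCommGroup M] [Module ℂ M] (i : ZMod 2) (x : M) :
    ((-1 : ℤˣ) ^ i) • x = sgn i • x := by
  rcases zmod2_cases i with rfl | rfl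
  · simp
  · simp [Units.smul_def]

/-! ### Coproduct and antipode -/

/-- `U_q ⊗ U_q` with the product `(a ⊗ b)(c ⊗ d) = (-1)^{|b||c|} ac ⊗ bd`. -/
abbrev UqUq (η : ℝ) : Type := grading η ᵍ⊗[ℂ] grading η

/-- The pure tensor `a ⊗ b`. -/
def pure₂ (η : ℝ) (a b : Uq η) : UqUq η := GradedTensorProduct.tmul ℂ a b

theorem pure₂_mul {η : ℝ} {i j : ZMod 2} (a : Uq η) {b c : Uq η} (d : Uq η)
    (hb : b ∈ grading η j) (hc : c ∈ grading η i) :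
    pure₂ η a b * pure₂ η c d = sgn (j * i) • pure₂ η (a * c) (b * d) := by
  have := GradedTensorProduct.tmul_coe_mul_coe_tmul (R := ℂ) (grading η) (grading η) a
    (⟨b, hb⟩ : grading η j) (⟨c, hc⟩ : grading η i) d
  rw [units_smul_eq_sgn] at this
  exact this

theorem pure₂_add_left {η : ℝ} (a a' b : Uq η) :
    pure₂ η (a + a') b = pure₂ η a b + pure₂ η a' b := by
  simp [pure₂, GradedTensorProduct.tmul, TensorProduct.add_tmul]

theorem pure₂_add_right {η : ℝ} (a b b' : Uq η) :
    pure₂ η a (b + b') = pure₂ η a b + pure₂ η a b' := by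
  simp [pure₂, GradedTensorProduct.tmul, TensorProduct.tmul_add]

theorem pure₂_smul_left {η : ℝ} (r : ℂ) (a b : Uq η) :
    pure₂ η (r • a) b = r • pure₂ η a b := by
  rw [pure₂, GradedTensorProduct.tmul, ← TensorProduct.smul_tmul', map_smul]; rfl

theorem pure₂_smul_right {η : ℝ} (r : ℂ) (a b : Uq η) :
    pure₂ η a (r • b) = r • pure₂ η a b := by
  simp [pure₂, GradedTensorProduct.tmul, TensorProduct.tmul_smul]

theorem pure₂_sub_left {η : ℝ} (a a' b : Uq η) :
    pure₂ η (a - a') b = pure₂ η a b - pure₂ η a' b := by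
  simp [pure₂, GradedTensorProduct.tmul, TensorProduct.sub_tmul]

theorem pure₂_sub_right {η : ℝ} (a b b' : Uq η) :
    pure₂ η a (b - b') = pure₂ η a b - pure₂ η a b' := by
  simp [pure₂, GradedTensorProduct.tmul, TensorProduct.tmul_sub]

theorem qpow_mul (η x y : ℝ) : qpow η x * qpow η y = qpow η (x + y) :=
  (Real.rpow_add (Real.exp_pos _) x y).symm

theorem qpow_half_mul (η : ℝ) : (qpow η (1 / 2) : ℂ) * (qpow η (-1 / 2) : ℂ) = 1 := by
  rw [← Complex.ofReal_mul, qpow_mul]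
  norm_num [qpow]

/-- The coproduct on generators. -/
def coprodGen (η : ℝ) : Gen → UqUq η
  | .H => pure₂ η (ug η .H) 1 + pure₂ η 1 (ug η .H)
  | .vp => pure₂ η (ug η .vp) (ug η .K) + pure₂ η (ug η .Kinv) (ug η .vp)
  | .vm => pure₂ η (ug η .vm) (ug η .K) + pure₂ η (ug η .Kinv) (ug η .vm)
  | .K => pure₂ η (ug η .K) (ug η .K)
  | .Kinv => pure₂ η (ug η .Kinv) (ug η .Kinv)

/-- In any realization `K⁻¹` commutes with `v₊` up to `q^{-1/2}`. -/
theorem Realizes.vp_Kinv {η : ℝ} {B : Type*} [Ring B] [Algebra ℂ B] {x : Gen → B}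
    (h : Realizes η x) : x .vp * x .Kinv = (qpow η (1 / 2) : ℂ) • (x .Kinv * x .vp) := by
  calc x .vp * x .Kinv = x .Kinv * (x .K * x .vp) * x .Kinv := by
        rw [← mul_assoc, h.Kinv_K, one_mul]
    _ = _ := by
        rw [h.K_vp, mul_smul_comm, smul_mul_assoc, mul_assoc, mul_assoc, h.K_Kinv, mul_one]

theorem Realizes.vm_Kinv {η : ℝ} {B : Type*} [Ring B] [Algebra ℂ B] {x : Gen → B}
    (h : Realizes η x) : x .vm * x .Kinv = (qpow η (-1 / 2) : ℂ) • (x .Kinv * x .vm) := by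
  calc x .vm * x .Kinv = x .Kinv * (x .K * x .vm) * x .Kinv := by
        rw [← mul_assoc, h.Kinv_K, one_mul]
    _ = _ := by
        rw [h.K_vm, mul_smul_comm, smul_mul_assoc, mul_assoc, mul_assoc, h.K_Kinv, mul_one]

theorem Realizes.H_Kinv {η : ℝ} {B : Type*} [Ring B] [Algebra ℂ B] {x : Gen → B}
    (h : Realizes η x) : x .H * x .Kinv = x .Kinv * x .H := by
  calc x .H * x .Kinv = x .Kinv * (x .K * x .H) * x .Kinv := by
        rw [← mul_assoc, h.Kinv_K, one_mul]
    _ = _ := by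
        rw [← h.H_K, mul_assoc, mul_assoc, h.K_Kinv, mul_one]

theorem coprodGen_realizes (η : ℝ) : Realizes η (coprodGen η) := by
  have h := ug_realizes η
  have m1 : (1 : Uq η) ∈ grading η 0 := SetLike.GradedOne.one_mem
  have mH : ug η .H ∈ grading η 0 := ug_mem η .H
  have mK : ug η .K ∈ grading η 0 := ug_mem η .K
  have mk : ug η .Kinv ∈ grading η 0 := ug_mem η .Kinv
  have mp : ug η .vp ∈ grading η 1 := ug_mem η .vp
  have mm : ug η .vm ∈ grading η 1 := ug_mem η .vm
  have e {i j : ZMod 2} {b c : Uq η} (hb : b ∈ grading η j) (hc : c ∈ grading η i)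
      (a d : Uq η) := pure₂_mul a d hb hc
  constructor
  · simp only [coprodGen, e mK mk, mul_zero, sgn_zero, one_smul, h.K_Kinv]; rfl
  · simp only [coprodGen, e mk mK, mul_zero, sgn_zero, one_smul, h.Kinv_K]; rfl
  · simp only [coprodGen, mul_add, add_mul, e m1 mK, e mH mK, e mK mH, e mK m1, mul_zero,
      sgn_zero, one_smul, h.H_K, one_mul, mul_one]
  · simp only [coprodGen, mul_add, add_mul, e m1 mp, e m1 mk, e mH mp, e mH mk, e mK mH, e mK m1,
      e mp mH, e mp m1, mul_zero, sgn_zero, one_smul, h.H_K, h.H_vp, h.H_Kinv,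
      one_mul, mul_one, pure₂_add_left, pure₂_add_right, pure₂_smul_left, pure₂_smul_right,
      smul_add]
    abel
  · simp only [coprodGen, mul_add, add_mul, e m1 mm, e m1 mk, e mH mm, e mH mk, e mK mH, e mK m1,
      e mm mH, e mm m1, mul_zero, sgn_zero, one_smul, h.H_K, h.H_vm, h.H_Kinv,
      one_mul, mul_one, pure₂_sub_left, pure₂_sub_right, pure₂_smul_left, pure₂_smul_right,
      smul_add]
    abel
  · simp only [coprodGen, mul_add, add_mul, e mK mp, e mK mk, e mK mK, e mp mK,
      mul_zero, zero_mul, sgn_zero, one_smul, h.K_vp, h.K_Kinv, h.Kinv_K,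
      pure₂_smul_left, pure₂_smul_right, smul_add]
  · simp only [coprodGen, mul_add, add_mul, e mK mm, e mK mk, e mK mK, e mm mK,
      mul_zero, zero_mul, sgn_zero, one_smul, h.K_vm, h.K_Kinv, h.Kinv_K,
      pure₂_smul_left, pure₂_smul_right, smul_add]
  · have hq := qpow_half_mul η
    have hq' : (qpow η (-1 / 2) : ℂ) * (qpow η (1 / 2) : ℂ) = 1 := by rw [mul_comm]; exact hq
    have hvm : ug η .vm * ug η .vp = (1 / (2 * Real.sinh (2 * η)) : ℂ) •
        (ug η .K * ug η .K - ug η .Kinv * ug η .Kinv) - ug η .vp * ug η .vm := by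
      rw [← h.vp_vm]; abel
    simp only [coprodGen, mul_add, add_mul, e mK mm, e mK mp, e mK mk, e mp mm, e mp mk, e mm mp,
      e mm mk, e mK mK, e mk mk, mul_zero, mul_one, sgn_zero, sgn_one, one_smul,
      h.vp_Kinv, h.vm_Kinv, h.K_vp, h.K_vm, hvm, pure₂_smul_left, pure₂_smul_right,
      pure₂_sub_left, pure₂_sub_right, smul_smul, hq, hq', smul_sub]
    module

/-- The coproduct `Δ`. -/
def coproduct (η : ℝ) : Uq η →ₐ[ℂ] UqUq η :=
  liftUq η (coprodGen η) (coprodGen_realizes η)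

/-- Auxiliary images of the generators for the antipode. -/
def antipodeGen (η : ℝ) : Gen → (Uq η)ᵐᵒᵖ
  | .H => MulOpposite.op (-ug η .H)
  | .vp => MulOpposite.op ((-Complex.I * qpow η (1 / 2)) • ug η .vp)
  | .vm => MulOpposite.op ((-Complex.I * qpow η (-1 / 2)) • ug η .vm)
  | .K => MulOpposite.op (ug η .Kinv)
  | .Kinv => MulOpposite.op (ug η .K)

theorem antipodeGen_realizes (η : ℝ) : Realizes η (antipodeGen η) := by
  have h := ug_realizes η
  have hI : (-Complex.I * (qpow η (1 / 2) : ℂ)) * (-Complex.I * (qpow η (-1 / 2) : ℂ)) = -1 := by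
    linear_combination Complex.I * Complex.I * qpow_half_mul η + Complex.I_mul_I
  constructor <;> apply MulOpposite.unop_injective <;>
    simp only [antipodeGen, MulOpposite.unop_mul, MulOpposite.unop_op, MulOpposite.unop_one,
      MulOpposite.unop_add, MulOpposite.unop_sub, MulOpposite.unop_smul]
  · exact h.K_Kinv
  · exact h.Kinv_K
  · simp [h.H_Kinv]
  · simp only [mul_neg, neg_mul, smul_mul_assoc, mul_smul_comm, h.H_vp]
    module
  · simp only [mul_neg, neg_mul, smul_mul_assoc, mul_smul_comm, h.H_vm]
    module
  · simp only [smul_mul_assoc, mul_smul_comm, h.vp_Kinv]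
    module
  · simp only [smul_mul_assoc, mul_smul_comm, h.vm_Kinv]
    module
  · simp only [smul_mul_assoc, mul_smul_comm, smul_smul]
    rw [hI, mul_comm, hI, ← smul_add, add_comm, h.vp_vm]
    module

/-- An ordinary algebra anti-homomorphism `S'`, related to the antipode `S` by `S' a = S a` for
even `a` and `S' a = i (S a)` for odd `a`. -/
def antipodeAux (η : ℝ) : Uq η →ₐ[ℂ] (Uq η)ᵐᵒᵖ :=
  liftUq η (antipodeGen η) (antipodeGen_realizes η)

/-- The antipode `S`: the linear map with `S(1) = 1`, `S(H) = -H`, `S(v±) = -q^{±1/2} v±`,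
`S(q^{±H}) = q^{∓H}` and `S(ab) = (-1)^{|a||b|} S(b) S(a)` for homogeneous `a`, `b`
(see `antipode_one`, `antipode_H`, ..., `antipode_mul`). -/
def antipode (η : ℝ) : Uq η →ₗ[ℂ] Uq η :=
  (MulOpposite.opLinearEquiv ℂ).symm.toLinearMap ∘ₗ (antipodeAux η).toLinearMap ∘ₗ
    (comp η 0 - Complex.I • comp η 1)

/-- The phase `1` for even, `-i` for odd. -/
def iphase (i : ZMod 2) : ℂ := if i = 0 then 1 else -Complex.I

theorem antipode_of_mem {η : ℝ} {i : ZMod 2} {a : Uq η} (h : a ∈ grading η i) :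
    antipode η a = iphase i • (antipodeAux η a).unop := by
  rcases zmod2_cases i with rfl | rfl <;>
    simp [antipode, comp_of_mem h, iphase]

theorem antipode_mul {η : ℝ} {i j : ZMod 2} {a b : Uq η} (ha : a ∈ grading η i)
    (hb : b ∈ grading η j) :
    antipode η (a * b) = sgn (i * j) • (antipode η b * antipode η a) := by
  rw [antipode_of_mem ha, antipode_of_mem hb, antipode_of_mem (SetLike.GradedMul.mul_mem ha hb),
    map_mul, MulOpposite.unop_mul, smul_mul_smul_comm, smul_smul]
  congr 1
  rcases zmod2_cases i with rfl | rfl <;> rcases zmod2_cases j with rfl | rfl <;>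
    simp [iphase, show (1 + 1 : ZMod 2) = 0 from by decide]

theorem antipode_one (η : ℝ) : antipode η 1 = 1 := by
  rw [antipode_of_mem (i := 0) SetLike.GradedOne.one_mem]
  simp [iphase]

theorem antipode_H (η : ℝ) : antipode η (ug η .H) = -ug η .H := by
  rw [antipode_of_mem (ug_mem η .H)]
  simp [iphase, Gen.deg, antipodeAux, antipodeGen]

theorem antipode_K (η : ℝ) : antipode η (ug η .K) = ug η .Kinv := by
  rw [antipode_of_mem (ug_mem η .K)]
  simp [iphase, Gen.deg, antipodeAux, antipodeGen]

theorem antipode_Kinv (η : ℝ) : antipode η (ug η .Kinv) = ug η .K := by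
  rw [antipode_of_mem (ug_mem η .Kinv)]
  simp [iphase, Gen.deg, antipodeAux, antipodeGen]

theorem antipode_vp (η : ℝ) :
    antipode η (ug η .vp) = -((qpow η (1 / 2) : ℂ) • ug η .vp) := by
  rw [antipode_of_mem (ug_mem η .vp)]
  simp [iphase, Gen.deg, antipodeAux, antipodeGen, smul_smul, ← mul_assoc]

theorem antipode_vm (η : ℝ) :
    antipode η (ug η .vm) = -((qpow η (-1 / 2) : ℂ) • ug η .vm) := by
  rw [antipode_of_mem (ug_mem η .vm)]
  simp [iphase, Gen.deg, antipodeAux, antipodeGen, smul_smul, ← mul_assoc]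

/-! ### Graded representations -/

/-- A graded representation of `U_q[osp(1|2)]` in `V`.  The `ℤ/2`-grading of the complex vector
space `V` is given by its parity involution (`+1` on even, `-1` on odd vectors). -/
structure GradedRep (η : ℝ) (V : Type*) [AddCommGroup V] [Module ℂ V] where
  par : Module.End ℂ V
  par_mul_par : par * par = 1
  act : Uq η →ₐ[ℂ] Module.End ℂ V
  act_parity : ∀ a, act (parityAut η a) = par * act a * par

/-- The homogeneous component of degree `i`. -/
def GradedRep.homog {η : ℝ} {V : Type*} [AddCommGroup V] [Module ℂ V] (ρ : GradedRep η V)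
    (i : ZMod 2) : Submodule ℂ V :=
  Module.End.eigenspace ρ.par (sgn i)

/-- An algebra homomorphism compatible with parity on generators is compatible with parity. -/
theorem parity_of_gen {η : ℝ} {B : Type*} [Ring B] [Algebra ℂ B] {P : B} (hP : P * P = 1)
    (f : Uq η →ₐ[ℂ] B) (h : ∀ g, sgn g.deg • f (ug η g) = P * f (ug η g) * P) (a : Uq η) :
    f (parityAut η a) = P * f a * P := by
  let c : Uq η →ₐ[ℂ] B := AlgHom.ofLinearMap
    (LinearMap.mulRight ℂ P ∘ₗ LinearMap.mulLeft ℂ P ∘ₗ f.toLinearMap)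
    (by simp [hP])
    (by
      intro x y
      simp only [LinearMap.comp_apply, LinearMap.mulRight_apply, LinearMap.mulLeft_apply,
        AlgHom.toLinearMap_apply, map_mul]
      calc P * (f x * f y) * P = P * f x * 1 * f y * P := by simp [mul_assoc]
        _ = _ := by rw [← hP]; simp only [mul_assoc])
  have : f.comp (parityAut η) = c := by
    apply Uq_hom_ext
    intro g
    simpa [c] using h g
  exact DFunLike.congr_fun this a

theorem GradedRep.act_of_mem {η : ℝ} {V : Type*} [AddCommGroup V] [Module ℂ V]
    (ρ : GradedRep η V) {i : ZMod 2} {a : Uq η} (ha : a ∈ grading η i) :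
    ρ.par * ρ.act a = sgn i • (ρ.act a * ρ.par) := by
  rw [mem_grading] at ha
  have h := ρ.act_parity a
  rw [ha, map_smul] at h
  rw [← smul_mul_assoc, h, mul_assoc, ρ.par_mul_par, mul_one]

theorem antipode_mem {η : ℝ} {i : ZMod 2} {a : Uq η} (ha : a ∈ grading η i) :
    antipode η a ∈ grading η i := by
  have key : ((parityAut η).comp (AlgHom.id ℂ (Uq η))).op.comp (antipodeAux η)
      = (antipodeAux η).comp (parityAut η) := by
    apply Uq_hom_ext
    intro g
    apply MulOpposite.unop_injective
    cases g <;> simp [antipodeAux, antipodeGen, Gen.deg]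
  have := congrArg MulOpposite.unop (DFunLike.congr_fun key a)
  rw [mem_grading, antipode_of_mem ha, map_smul, smul_comm (sgn i)]
  congr 1
  rw [mem_grading] at ha
  simpa [ha] using this

/-- `P^i` for an involution `P` and `i ∈ ℤ/2`. -/
def ipow {B : Type*} [Ring B] (P : B) (i : ZMod 2) : B := if i = 0 then 1 else P

section Hom

variable {η : ℝ} {V W : Type*} [AddCommGroup V] [Module ℂ V] [AddCommGroup W] [Module ℂ W]
  (ρ : GradedRep η V) (σ : GradedRep η W)

/-- The parity of `Hom(V, W)`: a map `φ` is homogeneous of degree `i` if and only if it shifts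
degrees by `i`, that is, if and only if `par ∘ φ ∘ par = (-1)^i φ`. -/
def homPar : Module.End ℂ (V →ₗ[ℂ] W) :=
  LinearMap.llcomp ℂ V W W σ.par ∘ₗ (LinearMap.llcomp ℂ V V W).flip ρ.par

theorem homPar_apply (φ : V →ₗ[ℂ] W) : homPar ρ σ φ = σ.par ∘ₗ φ ∘ₗ ρ.par := rfl

theorem homPar_mul_homPar : homPar ρ σ * homPar ρ σ = 1 := by
  ext φ v
  have h1 : ∀ x, ρ.par (ρ.par x) = x := fun x => DFunLike.congr_fun ρ.par_mul_par x
  have h2 : ∀ x, σ.par (σ.par x) = x := fun x => DFunLike.congr_fun σ.par_mul_par x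
  simp [homPar_apply, h1, h2]

/-- Left factor of the action on `Hom(V, W)`: `φ ↦ σ(a) ∘ φ`. -/
def homLeft : Uq η →ₐ[ℂ] Module.End ℂ (V →ₗ[ℂ] W) :=
  AlgHom.ofLinearMap (LinearMap.llcomp ℂ V W W ∘ₗ σ.act.toLinearMap)
    (by ext; simp) (by intro a b; ext; simp)

/-- Right factor of the action on `Hom(V, W)`: `φ ↦ (-1)^{|b||φ|} φ ∘ ρ(S(b))`, for homogeneous
`b` and `φ`. -/
def homRightLin : Uq η →ₗ[ℂ] Module.End ℂ (V →ₗ[ℂ] W) :=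
  let r : Uq η →ₗ[ℂ] Module.End ℂ (V →ₗ[ℂ] W) :=
    (LinearMap.llcomp ℂ V V W).flip ∘ₗ ρ.act.toLinearMap ∘ₗ antipode η
  r ∘ₗ comp η 0 + LinearMap.mulRight ℂ (homPar ρ σ) ∘ₗ r ∘ₗ comp η 1

theorem homRightLin_of_mem {j : ZMod 2} {b : Uq η} (hb : b ∈ grading η j) (φ : V →ₗ[ℂ] W) :
    homRightLin ρ σ b φ = ipow (homPar ρ σ) j φ ∘ₗ ρ.act (antipode η b) := by
  rcases zmod2_cases j with rfl | rfl <;> ext v <;>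
    simp [homRightLin, ipow, comp_of_mem hb]

theorem GradedRep.par_par (v : V) : ρ.par (ρ.par v) = v := DFunLike.congr_fun ρ.par_mul_par v

theorem GradedRep.par_act {j : ZMod 2} {b : Uq η} (hb : b ∈ grading η j) (v : V) :
    ρ.par (ρ.act b v) = sgn j • ρ.act b (ρ.par v) :=
  DFunLike.congr_fun (ρ.act_of_mem hb) v

theorem homPar_homRightLin {j : ZMod 2} {b : Uq η} (hb : b ∈ grading η j) :
    homPar ρ σ * homRightLin ρ σ b = sgn j • (homRightLin ρ σ b * homPar ρ σ) := by
  have hS := ρ.par_act (antipode_mem hb)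
  ext φ v
  simp only [Module.End.mul_apply, LinearMap.smul_apply, homRightLin_of_mem ρ σ hb]
  rcases zmod2_cases j with rfl | rfl <;>
    simp [ipow, homPar_apply, hS, GradedRep.par_par]

theorem homPar_homLeft {i : ZMod 2} {a : Uq η} (ha : a ∈ grading η i) :
    homPar ρ σ * homLeft (V := V) σ a = sgn i • (homLeft σ a * homPar ρ σ) := by
  ext φ v
  simp [homPar_apply, homLeft, σ.par_act ha]

theorem Uq_hom_induction {p : Uq η → Prop} (hadd : ∀ a b, p a → p b → p (a + b))
    (hom : ∀ i, ∀ a ∈ grading η i, p a) (a : Uq η) : p a := by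
  rw [← comp_add η a]
  exact hadd _ _ (hom 0 _ (comp_mem η 0 a)) (hom 1 _ (comp_mem η 1 a))

theorem homRightLin_mul (a b : Uq η) :
    homRightLin ρ σ (a * b) = homRightLin ρ σ a * homRightLin ρ σ b := by
  induction a using Uq_hom_induction with
  | hadd a a' h h' => rw [add_mul, map_add, map_add, h, h', add_mul]
  | hom i a ha =>
    induction b using Uq_hom_induction with
    | hadd b b' h h' => rw [mul_add, map_add, map_add, h, h', mul_add]
    | hom j b hb =>
      have hS := ρ.par_act (antipode_mem hb)
      ext φ v
      simp only [Module.End.mul_apply, homRightLin_of_mem ρ σ ha, homRightLin_of_mem ρ σ hb,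
        homRightLin_of_mem ρ σ (SetLike.GradedMul.mul_mem ha hb), antipode_mul ha hb]
      rcases zmod2_cases i with rfl | rfl <;> rcases zmod2_cases j with rfl | rfl <;>
        simp [ipow, homPar_apply, hS, GradedRep.par_par, show (1 + 1 : ZMod 2) = 0 from by decide]

/-- `homRightLin` as an algebra homomorphism. -/
def homRight : Uq η →ₐ[ℂ] Module.End ℂ (V →ₗ[ℂ] W) :=
  AlgHom.ofLinearMap (homRightLin ρ σ)
    (by
      ext φ v
      rw [homRightLin_of_mem ρ σ (j := 0) SetLike.GradedOne.one_mem]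
      simp [ipow, antipode_one])
    (homRightLin_mul ρ σ)

theorem homRight_apply (b : Uq η) : homRight ρ σ b = homRightLin ρ σ b := rfl

theorem homLeft_homRight ⦃i j : ZMod 2⦄ (a : grading η i) (b : grading η j) :
    homLeft σ (a : Uq η) * homRight ρ σ b
      = (-1 : ℤˣ) ^ (j * i) • (homRight ρ σ b * homLeft σ (a : Uq η)) := by
  have ha := σ.par_act a.2
  rw [units_smul_eq_sgn]
  ext φ v
  simp only [Module.End.mul_apply, LinearMap.smul_apply, homRight_apply,
    homRightLin_of_mem ρ σ b.2]
  rcases zmod2_cases i with rfl | rfl <;> rcases zmod2_cases j with rfl | rfl <;>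
    simp [ipow, homPar_apply, homLeft, ha]

/-- The action `δ(a) φ = ∑ (-1)^{|a₂||φ|} σ(a₁) ∘ φ ∘ ρ(S(a₂))` on `Hom(V, W)`, where
`Δ(a) = ∑ a₁ ⊗ a₂`. -/
def homAct : Uq η →ₐ[ℂ] Module.End ℂ (V →ₗ[ℂ] W) :=
  (GradedTensorProduct.lift (grading η) (grading η) (homLeft σ) (homRight ρ σ)
    (homLeft_homRight ρ σ)).comp (coproduct η)

/-- Two factors that are graded with respect to `P` give a representation graded with respect to
`P`. -/
theorem lift_parity {B : Type*} [Ring B] [Algebra ℂ B] {P : B} (hP : P * P = 1)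
    (f g : Uq η →ₐ[ℂ] B)
    (hfg : ∀ ⦃i j : ZMod 2⦄ (a : grading η i) (b : grading η j),
      f (a : Uq η) * g b = (-1 : ℤˣ) ^ (j * i) • (g b * f (a : Uq η)))
    (hf : ∀ i, ∀ a ∈ grading η i, P * f a = sgn i • (f a * P))
    (hg : ∀ i, ∀ a ∈ grading η i, P * g a = sgn i • (g a * P)) (a : Uq η) :
    ((GradedTensorProduct.lift (grading η) (grading η) f g hfg).comp (coproduct η))
      (parityAut η a)
    = P * ((GradedTensorProduct.lift (grading η) (grading η) f g hfg).comp (coproduct η)) a * P := by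
  apply parity_of_gen hP
  have key (i j : ZMod 2) (a b : Uq η) (ha : a ∈ grading η i) (hb : b ∈ grading η j) :
      P * (f a * g b) * P = sgn (i + j) • (f a * g b) := by
    calc P * (f a * g b) * P = (P * f a) * g b * P := by simp only [mul_assoc]
      _ = sgn i • (f a * (P * g b) * P) := by
        rw [hf i a ha]; simp only [smul_mul_assoc, mul_assoc]
      _ = _ := by
        rw [hg j b hb, sgn_add, mul_smul_comm, smul_mul_assoc, smul_smul, mul_assoc, mul_assoc,
          hP, mul_one]
  have m1 : (1 : Uq η) ∈ grading η 0 := SetLike.GradedOne.one_mem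
  intro x
  have hx := ug_mem η x
  have hK := ug_mem η .K
  have hk := ug_mem η .Kinv
  cases x <;>
    simp only [AlgHom.comp_apply, coproduct, liftUq_ug, coprodGen, map_add, pure₂,
      GradedTensorProduct.lift_tmul, mul_add, add_mul, smul_add, key _ _ _ _ hx m1,
      key _ _ _ _ m1 hx, key _ _ _ _ hx hK, key _ _ _ _ hk hx] <;>
    simp [Gen.deg]

/-- The graded representation `Hom(V, W)`. -/
def GradedRep.hom : GradedRep η (V →ₗ[ℂ] W) where
  par := homPar ρ σ
  par_mul_par := homPar_mul_homPar ρ σ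
  act := homAct ρ σ
  act_parity := lift_parity (homPar_mul_homPar ρ σ) _ _ _
    (fun _ _ ha => homPar_homLeft ρ σ ha) (fun _ _ hb => homPar_homRightLin ρ σ hb)

end Hom

section Tensor

variable {η : ℝ} {V W : Type*} [AddCommGroup V] [Module ℂ V] [AddCommGroup W] [Module ℂ W]
  (ρ : GradedRep η V) (σ : GradedRep η W)

/-- The parity of `V ⊗ W`. -/
def tensorPar : Module.End ℂ (V ⊗[ℂ] W) := TensorProduct.map ρ.par σ.par

theorem tensorPar_mul_tensorPar : tensorPar ρ σ * tensorPar ρ σ = 1 := by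
  ext v w
  simp [tensorPar, GradedRep.par_par]

/-- Left factor of the action on `V ⊗ W`: `v ⊗ w ↦ ρ(a) v ⊗ w`. -/
def tensorLeft : Uq η →ₐ[ℂ] Module.End ℂ (V ⊗[ℂ] W) :=
  (Module.End.rTensorAlgHom ℂ V W).comp ρ.act

theorem tensorLeft_tmul (a : Uq η) (v : V) (w : W) :
    tensorLeft ρ a (v ⊗ₜ[ℂ] w) = ρ.act a v ⊗ₜ[ℂ] w := rfl

/-- Right factor of the action on `V ⊗ W`: `v ⊗ w ↦ (-1)^{|b||v|} v ⊗ σ(b) w`, for homogeneous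
`b` and `v`. -/
def tensorRightLin : Uq η →ₗ[ℂ] Module.End ℂ (V ⊗[ℂ] W) :=
  let r : Uq η →ₗ[ℂ] Module.End ℂ (V ⊗[ℂ] W) := LinearMap.lTensorHom V ∘ₗ σ.act.toLinearMap
  r ∘ₗ comp η 0 + LinearMap.mulRight ℂ (LinearMap.rTensor W ρ.par) ∘ₗ r ∘ₗ comp η 1

theorem tensorRightLin_of_mem {j : ZMod 2} {b : Uq η} (hb : b ∈ grading η j) (v : V) (w : W) :
    tensorRightLin ρ σ b (v ⊗ₜ[ℂ] w) = ipow ρ.par j v ⊗ₜ[ℂ] σ.act b w := by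
  rcases zmod2_cases j with rfl | rfl <;>
    simp [tensorRightLin, ipow, comp_of_mem hb]

theorem tensorRightLin_mul (a b : Uq η) :
    tensorRightLin ρ σ (a * b) = tensorRightLin ρ σ a * tensorRightLin ρ σ b := by
  induction a using Uq_hom_induction with
  | hadd a a' h h' => rw [add_mul, map_add, map_add, h, h', add_mul]
  | hom i a ha =>
    induction b using Uq_hom_induction with
    | hadd b b' h h' => rw [mul_add, map_add, map_add, h, h', mul_add]
    | hom j b hb =>
      ext v w
      simp only [TensorProduct.AlgebraTensorModule.curry_apply, LinearMap.restrictScalars_self,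
        TensorProduct.curry_apply, Module.End.mul_apply, tensorRightLin_of_mem ρ σ ha,
        tensorRightLin_of_mem ρ σ hb, tensorRightLin_of_mem ρ σ (SetLike.GradedMul.mul_mem ha hb)]
      rcases zmod2_cases i with rfl | rfl <;> rcases zmod2_cases j with rfl | rfl <;>
        simp [ipow, GradedRep.par_par, show (1 + 1 : ZMod 2) = 0 from by decide]

/-- `tensorRightLin` as an algebra homomorphism. -/
def tensorRight : Uq η →ₐ[ℂ] Module.End ℂ (V ⊗[ℂ] W) :=
  AlgHom.ofLinearMap (tensorRightLin ρ σ)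
    (by
      ext v w
      simp [tensorRightLin_of_mem ρ σ (j := 0) SetLike.GradedOne.one_mem, ipow])
    (tensorRightLin_mul ρ σ)

theorem tensorRight_apply (b : Uq η) : tensorRight ρ σ b = tensorRightLin ρ σ b := rfl

theorem tensorLeft_tensorRight ⦃i j : ZMod 2⦄ (a : grading η i) (b : grading η j) :
    tensorLeft ρ (a : Uq η) * tensorRight ρ σ b
      = (-1 : ℤˣ) ^ (j * i) • (tensorRight ρ σ b * tensorLeft ρ (a : Uq η)) := by
  have ha := ρ.par_act a.2
  rw [units_smul_eq_sgn]
  ext v w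
  simp only [TensorProduct.AlgebraTensorModule.curry_apply, LinearMap.restrictScalars_self,
    TensorProduct.curry_apply, Module.End.mul_apply, LinearMap.smul_apply, tensorRight_apply,
    tensorLeft_tmul, tensorRightLin_of_mem ρ σ b.2]
  rcases zmod2_cases i with rfl | rfl <;> rcases zmod2_cases j with rfl | rfl <;>
    simp [ipow, ha, TensorProduct.neg_tmul]

/-- The action `a (v ⊗ w) = ∑ (-1)^{|a₂||v|} ρ(a₁) v ⊗ σ(a₂) w` on `V ⊗ W`, where
`Δ(a) = ∑ a₁ ⊗ a₂`. -/
def tensorAct : Uq η →ₐ[ℂ] Module.End ℂ (V ⊗[ℂ] W) :=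
  (GradedTensorProduct.lift (grading η) (grading η) (tensorLeft ρ) (tensorRight ρ σ)
    (tensorLeft_tensorRight ρ σ)).comp (coproduct η)

theorem tensorPar_tensorLeft {i : ZMod 2} {a : Uq η} (ha : a ∈ grading η i) :
    tensorPar ρ σ * tensorLeft ρ a = sgn i • (tensorLeft ρ a * tensorPar ρ σ) := by
  ext v w
  simp [tensorPar, tensorLeft_tmul, ρ.par_act ha, TensorProduct.smul_tmul']

theorem tensorPar_tensorRight {i : ZMod 2} {b : Uq η} (hb : b ∈ grading η i) :
    tensorPar ρ σ * tensorRight ρ σ b = sgn i • (tensorRight ρ σ b * tensorPar ρ σ) := by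
  ext v w
  simp only [TensorProduct.AlgebraTensorModule.curry_apply, LinearMap.restrictScalars_self,
    TensorProduct.curry_apply, Module.End.mul_apply, LinearMap.smul_apply, tensorRight_apply,
    tensorPar, TensorProduct.map_tmul, tensorRightLin_of_mem ρ σ hb, σ.par_act hb]
  rcases zmod2_cases i with rfl | rfl <;> simp [ipow, TensorProduct.tmul_neg]

/-- The tensor product of two graded representations. -/
def GradedRep.tensor : GradedRep η (V ⊗[ℂ] W) where
  par := tensorPar ρ σ
  par_mul_par := tensorPar_mul_tensorPar ρ σ
  act := tensorAct ρ σ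
  act_parity := lift_parity (tensorPar_mul_tensorPar ρ σ) _ _ _
    (fun _ _ ha => tensorPar_tensorLeft ρ σ ha) (fun _ _ hb => tensorPar_tensorRight ρ σ hb)

end Tensor

/-! ### Graded intertwiners and tensor operators -/

section Intertwiner

variable {η : ℝ} {V W U : Type*} [AddCommGroup V] [Module ℂ V] [AddCommGroup W] [Module ℂ W]
  [AddCommGroup U] [Module ℂ U]

/-- The graded intertwiners of degree `d`: linear maps `f` that are homogeneous of degree `d` and
satisfy `f ∘ ρ(a) = (-1)^{|a| d} σ(a) ∘ f` for every homogeneous `a`. -/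
def intertwiners (ρ : GradedRep η V) (σ : GradedRep η W) (d : ZMod 2) :
    Submodule ℂ (V →ₗ[ℂ] W) where
  carrier := {f | (∀ i, ∀ v ∈ ρ.homog i, f v ∈ σ.homog (i + d)) ∧
    ∀ i, ∀ a ∈ grading η i, f ∘ₗ ρ.act a = sgn (i * d) • (σ.act a ∘ₗ f)}
  add_mem' := by
    rintro f g ⟨hf, hf'⟩ ⟨hg, hg'⟩
    refine ⟨fun i v hv => Submodule.add_mem _ (hf i v hv) (hg i v hv), fun i a ha => ?_⟩
    rw [LinearMap.add_comp, LinearMap.comp_add, hf' i a ha, hg' i a ha, smul_add]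
  zero_mem' := ⟨fun i v _ => Submodule.zero_mem _, fun i a _ => by simp⟩
  smul_mem' := by
    rintro c f ⟨hf, hf'⟩
    refine ⟨fun i v hv => Submodule.smul_mem _ c (hf i v hv), fun i a ha => ?_⟩
    rw [LinearMap.smul_comp, LinearMap.comp_smul, hf' i a ha, smul_comm]

/-- The space `I(V, W)` of all graded intertwiners, spanned by the even and the odd ones. -/
def allIntertwiners (ρ : GradedRep η V) (σ : GradedRep η W) : Submodule ℂ (V →ₗ[ℂ] W) :=
  intertwiners ρ σ 0 ⊔ intertwiners ρ σ 1

/-- Tensor operators: graded intertwiners from `V` to `Hom(W, U)`. -/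
def tensorOperators (ρ : GradedRep η V) (σ : GradedRep η W) (τ : GradedRep η U) :
    Submodule ℂ (V →ₗ[ℂ] W →ₗ[ℂ] U) :=
  allIntertwiners ρ (σ.hom τ)

/-- Even tensor operators: homomorphisms of representations from `V` to `Hom(W, U)`. -/
def evenTensorOperators (ρ : GradedRep η V) (σ : GradedRep η W) (τ : GradedRep η U) :
    Submodule ℂ (V →ₗ[ℂ] W →ₗ[ℂ] U) :=
  intertwiners ρ (σ.hom τ) 0

end Intertwiner

/-! ### The irreducible representations -/

/-- The index set `{-l, ..., l}`. -/
abbrev Wt (l : ℕ) : Type := {m : ℤ // m ∈ Finset.Icc (-(l : ℤ)) l}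

/-- The highest weight `m = l`. -/
def Wt.top (l : ℕ) : Wt l := ⟨l, by simp⟩

/-- The space `V^l` of dimension `2l + 1`. -/
abbrev Vsp (l : ℕ) : Type := Wt l → ℂ

/-- The basis vector `e^l_m`. -/
def bv {l : ℕ} (m : Wt l) : Vsp l := Pi.single m 1

/-- The deformed number `[n] = (q^{-n/2} - (-1)^n q^{n/2}) / (q^{-1/2} + q^{1/2})`. -/
def qnum (η : ℝ) (n : ℤ) : ℝ :=
  (qpow η (-n / 2) - (-1) ^ n * qpow η (n / 2)) / (qpow η (-1 / 2) + qpow η (1 / 2))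

/-- The constant `γ = cosh(η/4) / sinh(2η)`. -/
def gam (η : ℝ) : ℝ := Real.cosh (η / 4) / Real.sinh (2 * η)

/-- `v₊ e_m = raiseCoeff e_{m+1}`. -/
def raiseCoeff (η : ℝ) (l : ℕ) (m : ℤ) : ℝ :=
  (-1) ^ (l - m) * √(qnum η (l - m) * qnum η (l + m + 1) * gam η)

/-- `v₋ e_m = lowerCoeff e_{m-1}`. -/
def lowerCoeff (η : ℝ) (l : ℕ) (m : ℤ) : ℝ :=
  √(qnum η (l + m) * qnum η (l - m + 1) * gam η)

/-- The matrices of the generators in `V^l`; the entry in row `m'` and column `m` is the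
coefficient of `e_{m'}` in the image of `e_m`. -/
def irrepMat (η : ℝ) (l : ℕ) : Gen → Matrix (Wt l) (Wt l) ℂ
  | .H => Matrix.diagonal fun m => (m : ℂ) / 2
  | .vp => Matrix.of fun m' m => if (m' : ℤ) = m + 1 then (raiseCoeff η l m : ℂ) else 0
  | .vm => Matrix.of fun m' m => if (m' : ℤ) = m - 1 then (lowerCoeff η l m : ℂ) else 0
  | .K => Matrix.diagonal fun m => (qpow η ((m : ℤ) / 2) : ℂ)
  | .Kinv => Matrix.diagonal fun m => (qpow η (-(m : ℤ) / 2) : ℂ)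

theorem qpow_eq_exp (η x : ℝ) : qpow η x = Real.exp (-(η * x) / 2) := by
  rw [qpow, qpar, ← Real.exp_mul]
  ring_nf

theorem qnum_den_pos (η : ℝ) : 0 < qpow η (-1 / 2) + qpow η (1 / 2) := by
  rw [qpow_eq_exp, qpow_eq_exp]; positivity

theorem qnum_even_mul_gam_nonneg (η : ℝ) {n : ℤ} (hn : 0 ≤ n) (he : Even n) :
    0 ≤ qnum η n * gam η := by
  have h0 := qnum_den_pos η
  have hnum : qpow η (-n / 2) - qpow η (n / 2) = 2 * Real.sinh (η * n / 4) := by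
    rw [qpow_eq_exp, qpow_eq_exp, Real.sinh_eq]; ring_nf
  have hn' : (0 : ℝ) ≤ n := by exact_mod_cast hn
  have hc := Real.cosh_pos (η / 4)
  rw [qnum, gam, he.neg_one_zpow, one_mul, hnum, div_mul_div_comm]
  rcases le_total 0 η with h | h
  · have h1 : 0 ≤ Real.sinh (η * n / 4) := Real.sinh_nonneg_iff.2 (by positivity)
    have h2 : 0 ≤ Real.sinh (2 * η) := Real.sinh_nonneg_iff.2 (by positivity)
    positivity
  · have h1 : Real.sinh (η * n / 4) ≤ 0 := Real.sinh_nonpos_iff.2 (by nlinarith)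
    have h2 : Real.sinh (2 * η) ≤ 0 := Real.sinh_nonpos_iff.2 (by linarith)
    apply div_nonneg_of_nonpos
    · nlinarith
    · nlinarith

theorem qnum_odd_nonneg (η : ℝ) {n : ℤ} (ho : Odd n) : 0 ≤ qnum η n := by
  have h0 := qnum_den_pos η
  rw [qnum, ho.neg_one_zpow]
  apply div_nonneg _ h0.le
  rw [qpow_eq_exp, qpow_eq_exp, neg_one_mul, sub_neg_eq_add]
  positivity

theorem qnum_prod_nonneg (η : ℝ) {a b : ℤ} (ha : 0 ≤ a) (hb : 0 ≤ b) (hab : Odd (a + b)) :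
    0 ≤ qnum η a * qnum η b * gam η := by
  rcases Int.even_or_odd a with h | h
  · have hb' : Odd b := by
      rcases Int.even_or_odd b with h' | h'
      · exact absurd (h.add h') (Int.not_even_iff_odd.2 hab)
      · exact h'
    have := mul_nonneg (qnum_even_mul_gam_nonneg η ha h) (qnum_odd_nonneg η hb')
    linarith
  · have hb' : Even b := by
      rcases Int.even_or_odd b with h' | h'
      · exact h'
      · exact absurd (h.add_odd h') (Int.not_even_iff_odd.2 hab)
    have := mul_nonneg (qnum_even_mul_gam_nonneg η hb hb') (qnum_odd_nonneg η h)
    linarith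

theorem irrep_scalar (η : ℝ) (l : ℕ) (m : ℤ) (h1 : -l ≤ m) (h2 : m ≤ l) :
    raiseCoeff η l (m - 1) * lowerCoeff η l m + lowerCoeff η l (m + 1) * raiseCoeff η l m
      = 1 / (2 * Real.sinh (2 * η)) *
        (qpow η (m / 2) * qpow η (m / 2) - qpow η (-m / 2) * qpow η (-m / 2)) := by
  have e1 : 0 ≤ qnum η (l + m) * qnum η (l - m + 1) * gam η :=
    qnum_prod_nonneg η (by omega) (by omega) ⟨l, by ring⟩
  have e2 : 0 ≤ qnum η (l - m) * qnum η (l + m + 1) * gam η :=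
    qnum_prod_nonneg η (by omega) (by omega) ⟨l, by ring⟩
  have p1 : raiseCoeff η l (m - 1) * lowerCoeff η l m
      = -(-1) ^ ((l : ℤ) - m) * (qnum η (l + m) * qnum η (l - m + 1) * gam η) := by
    rw [raiseCoeff, lowerCoeff, show (l : ℤ) - (m - 1) = l - m + 1 by ring,
      show (l : ℤ) + (m - 1) + 1 = l + m by ring, mul_comm (qnum η (l - m + 1)), mul_assoc,
      Real.mul_self_sqrt e1, zpow_add₀ (by norm_num), zpow_one]
    ring
  have p2 : lowerCoeff η l (m + 1) * raiseCoeff η l m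
      = (-1) ^ ((l : ℤ) - m) * (qnum η (l - m) * qnum η (l + m + 1) * gam η) := by
    rw [raiseCoeff, lowerCoeff, show (l : ℤ) - (m + 1) + 1 = l - m by ring,
      show (l : ℤ) + (m + 1) = l + m + 1 by ring, mul_comm (qnum η (l + m + 1)), mul_left_comm,
      Real.mul_self_sqrt e2]
  rw [p1, p2]
  have hs : ((-1 : ℝ) ^ ((l : ℤ) - m)) * ((-1 : ℝ) ^ ((l : ℤ) - m)) = 1 := by
    rw [← mul_zpow]; norm_num
  have hs2 : (-1 : ℝ) ^ ((l : ℤ) + m) = (-1 : ℝ) ^ ((l : ℤ) - m) := by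
    rw [show (l : ℤ) + m = (l - m) + (m + m) by ring, zpow_add₀ (by norm_num),
      (Even.neg_one_zpow ⟨m, rfl⟩ : (-1 : ℝ) ^ (m + m) = 1), mul_one]
  have hs3 : (-1 : ℝ) ^ ((l : ℤ) + m + 1) = -(-1 : ℝ) ^ ((l : ℤ) - m) := by
    rw [zpow_add₀ (by norm_num), hs2]; simp
  have hs4 : (-1 : ℝ) ^ ((l : ℤ) - m + 1) = -(-1 : ℝ) ^ ((l : ℤ) - m) := by
    rw [zpow_add₀ (by norm_num)]; simp
  simp only [qnum, gam, hs2, hs3, hs4, Real.cosh_eq]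
  generalize (-1 : ℝ) ^ ((l : ℤ) - m) = s at hs
  generalize Real.sinh (2 * η) = w
  obtain ⟨u, hu⟩ : ∃ u, Real.exp (η / 4) = u := ⟨_, rfl⟩
  obtain ⟨X, hX⟩ : ∃ X, Real.exp (η * (l - m) / 4) = X := ⟨_, rfl⟩
  obtain ⟨Y, hY⟩ : ∃ Y, Real.exp (η * (l + m) / 4) = Y := ⟨_, rfl⟩
  have u0 : 0 < u := hu ▸ Real.exp_pos _
  have X0 : 0 < X := hX ▸ Real.exp_pos _
  have Y0 : 0 < Y := hY ▸ Real.exp_pos _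
  have a0 : Real.exp (-(η / 4)) = u⁻¹ := by rw [← hu, ← Real.exp_neg]
  have a1 : qpow η (-1 / 2) = u := by rw [qpow_eq_exp, ← hu]; ring_nf
  have a2 : qpow η (1 / 2) = u⁻¹ := by rw [qpow_eq_exp, ← hu, ← Real.exp_neg]; ring_nf
  have b1 : qpow η (-((l : ℤ) - m : ℤ) / 2) = X := by
    rw [qpow_eq_exp, ← hX]; push_cast; ring_nf
  have b2 : qpow η (((l : ℤ) - m : ℤ) / 2) = X⁻¹ := by
    rw [qpow_eq_exp, ← hX, ← Real.exp_neg]; push_cast; ring_nf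
  have b3 : qpow η (-((l : ℤ) + m : ℤ) / 2) = Y := by
    rw [qpow_eq_exp, ← hY]; push_cast; ring_nf
  have b4 : qpow η (((l : ℤ) + m : ℤ) / 2) = Y⁻¹ := by
    rw [qpow_eq_exp, ← hY, ← Real.exp_neg]; push_cast; ring_nf
  have c1 : qpow η (-((l : ℤ) - m + 1 : ℤ) / 2) = X * u := by
    rw [qpow_eq_exp, ← hX, ← hu, ← Real.exp_add]; push_cast; ring_nf
  have c2 : qpow η (((l : ℤ) - m + 1 : ℤ) / 2) = X⁻¹ * u⁻¹ := by
    rw [qpow_eq_exp, ← hX, ← hu, ← Real.exp_neg, ← Real.exp_neg, ← Real.exp_add]; push_cast; ring_nf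
  have c3 : qpow η (-((l : ℤ) + m + 1 : ℤ) / 2) = Y * u := by
    rw [qpow_eq_exp, ← hY, ← hu, ← Real.exp_add]; push_cast; ring_nf
  have c4 : qpow η (((l : ℤ) + m + 1 : ℤ) / 2) = Y⁻¹ * u⁻¹ := by
    rw [qpow_eq_exp, ← hY, ← hu, ← Real.exp_neg, ← Real.exp_neg, ← Real.exp_add]; push_cast; ring_nf
  have d1 : qpow η (m / 2) * qpow η (m / 2) = X * Y⁻¹ := by
    rw [qpow_eq_exp, ← hX, ← hY, ← Real.exp_neg, ← Real.exp_add, ← Real.exp_add]; ring_nf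
  have d2 : qpow η (-m / 2) * qpow η (-m / 2) = X⁻¹ * Y := by
    rw [qpow_eq_exp, ← hX, ← hY, ← Real.exp_neg, ← Real.exp_add, ← Real.exp_add]; ring_nf
  rw [a0, a1, a2, b1, b2, b3, b4, c1, c2, c3, c4, d1, d2, hu]
  have key : 1 / (2 * w) = w⁻¹ / 2 := by rw [one_div, mul_inv]; ring
  rw [key, div_eq_mul_inv _ w]
  have hD : u + u⁻¹ ≠ 0 := by positivity
  have hu' : u * u⁻¹ = 1 := mul_inv_cancel₀ u0.ne'
  generalize w⁻¹ = z
  have hs' : s ^ 2 = 1 := by rw [pow_two]; exact hs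
  field_simp
  linear_combination z * (u ^ 2 + 1) * (X ^ 2 - Y ^ 2) * hs'

theorem irrepMat_realizes (η : ℝ) (l : ℕ) : Realizes η (irrepMat η l) := by
  have hK (m : ℤ) : qpow η (m / 2) * qpow η (-m / 2) = 1 := by
    rw [qpow_eq_exp, qpow_eq_exp, ← Real.exp_add]; ring_nf; simp
  have hKC (m : ℤ) : (qpow η (m / 2) : ℂ) * (qpow η (-m / 2) : ℂ) = 1 := by
    rw [← Complex.ofReal_mul, hK, Complex.ofReal_one]
  have hp (m : ℤ) : qpow η ((m + 1 : ℤ) / 2) = qpow η (1 / 2) * qpow η (m / 2) := by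
    rw [qpow_mul]; push_cast; ring_nf
  have hm (m : ℤ) : qpow η ((m - 1 : ℤ) / 2) = qpow η (-1 / 2) * qpow η (m / 2) := by
    rw [qpow_mul]; push_cast; ring_nf
  constructor
  · simp only [irrepMat, Matrix.diagonal_mul_diagonal, hKC, Matrix.diagonal_one]
  · have hKC' (m : ℤ) : (qpow η (-m / 2) : ℂ) * (qpow η (m / 2) : ℂ) = 1 := by
      rw [mul_comm, hKC]
    simp only [irrepMat, Matrix.diagonal_mul_diagonal, hKC', Matrix.diagonal_one]
  · simp only [irrepMat, Matrix.diagonal_mul_diagonal, mul_comm]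
  · ext i j
    simp only [irrepMat, Matrix.diagonal_mul, Matrix.add_apply, Matrix.mul_diagonal,
      Matrix.smul_apply, Matrix.of_apply]
    split_ifs with h
    · rw [h]; push_cast; simp only [smul_eq_mul]; ring
    · simp
  · ext i j
    simp only [irrepMat, Matrix.diagonal_mul, Matrix.sub_apply, Matrix.mul_diagonal,
      Matrix.smul_apply, Matrix.of_apply]
    split_ifs with h
    · rw [h]; push_cast; simp only [smul_eq_mul]; ring
    · simp
  · ext i j
    simp only [irrepMat, Matrix.diagonal_mul, Matrix.mul_diagonal, Matrix.smul_apply,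
      Matrix.of_apply]
    split_ifs with h
    · rw [h, hp]; push_cast; simp only [smul_eq_mul]; ring
    · simp
  · ext i j
    simp only [irrepMat, Matrix.diagonal_mul, Matrix.mul_diagonal, Matrix.smul_apply,
      Matrix.of_apply]
    split_ifs with h
    · rw [h, hm]; push_cast; simp only [smul_eq_mul]; ring
    · simp
  · have hsum (P : ℤ) (f : Wt l → ℂ) (F : ℂ) (hF : ∀ x : Wt l, (x : ℤ) = P → f x = F)
        (h0 : P ∉ Finset.Icc (-(l : ℤ)) l → F = 0) :
        (∑ x : Wt l, if (x : ℤ) = P then f x else 0) = F := by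
      by_cases h : P ∈ Finset.Icc (-(l : ℤ)) l
      · rw [Finset.sum_eq_single (⟨P, h⟩ : Wt l)]
        · simp [hF]
        · intro b _ hb
          rw [if_neg]
          intro hb'
          exact hb (Subtype.ext hb')
        · simp
      · rw [h0 h]
        apply Finset.sum_eq_zero
        intro x _
        rw [if_neg]
        intro hx
        exact h (hx ▸ x.2)
    have q0 : qnum η 0 = 0 := by simp [qnum]
    ext i j
    have hj := Finset.mem_Icc.1 j.2
    simp only [irrepMat, Matrix.diagonal_mul_diagonal, Matrix.add_apply, Matrix.smul_apply,
      Matrix.sub_apply, Matrix.mul_apply, Matrix.of_apply, mul_ite, mul_zero]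
    rw [hsum ((j : ℤ) - 1) _ (if (i : ℤ) = j then
        (raiseCoeff η l (j - 1) : ℂ) * (lowerCoeff η l j : ℂ) else 0),
      hsum ((j : ℤ) + 1) _ (if (i : ℤ) = j then
        (lowerCoeff η l (j + 1) : ℂ) * (raiseCoeff η l j : ℂ) else 0)]
    · by_cases h : i = j
      · subst h
        have := congrArg (fun x : ℝ => (x : ℂ)) (irrep_scalar η l i hj.1 hj.2)
        simp only [if_true, Matrix.diagonal_apply_eq, smul_eq_mul]
        push_cast at this ⊢
        exact this
      · have h' : (i : ℤ) ≠ j := fun hh => h (Subtype.ext hh)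
        simp [h, h']
    · intro x hx
      rw [hx]
      simp
    · intro h
      have : (j : ℤ) = l := by
        by_contra hne
        exact h (Finset.mem_Icc.2 ⟨by omega, by omega⟩)
      simp [this, raiseCoeff, q0]
    · intro x hx
      rw [hx]
      simp
    · intro h
      have : (j : ℤ) = -l := by
        by_contra hne
        exact h (Finset.mem_Icc.2 ⟨by omega, by omega⟩)
      simp [this, lowerCoeff, q0]

/-- The parity involution of `V^l(p)`: `|e_m| = l - m + p`. -/
def irrepPar (l : ℕ) (p : ZMod 2) : Matrix (Wt l) (Wt l) ℂ :=
  Matrix.diagonal fun m => sgn ((l : ZMod 2) - ((m : ℤ) : ZMod 2) + p)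

theorem irrepPar_mul_self (l : ℕ) (p : ZMod 2) : irrepPar l p * irrepPar l p = 1 := by
  simp [irrepPar, sgn_mul_self]

/-- The irreducible representation `V^l(p)` of highest weight `l` whose highest weight vector has
parity `p`. -/
def irrep (η : ℝ) (l : ℕ) (p : ZMod 2) : GradedRep η (Vsp l) where
  par := Matrix.toLinAlgEquiv' (irrepPar l p)
  par_mul_par := by rw [← map_mul, irrepPar_mul_self, map_one]
  act := (Matrix.toLinAlgEquiv' : Matrix (Wt l) (Wt l) ℂ ≃ₐ[ℂ] _).toAlgHom.comp
    (liftUq η (irrepMat η l) (irrepMat_realizes η l))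
  act_parity a := by
    have h := parity_of_gen (irrepPar_mul_self l p)
      (liftUq η (irrepMat η l) (irrepMat_realizes η l)) (fun g => ?_) a
    · simp [h]
    · have h1 : (1 + 1 : ZMod 2) = 0 := by decide
      have h2 (x : ZMod 2) : sgn (x + 1) = -sgn x := by simp [sgn_add]
      have h3 (x : ZMod 2) : sgn (x - 1) = -sgn x := by
        rw [show x - 1 = x + 1 by rw [sub_eq_add_neg]; rfl, h2]
      ext i j
      have hd (f : Wt l → ℂ) : 1 * Matrix.diagonal f i j = sgn ((l : ZMod 2) - ((i : ℤ) : ZMod 2) + p)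
          * Matrix.diagonal f i j * sgn ((l : ZMod 2) - ((j : ℤ) : ZMod 2) + p) := by
        by_cases h : i = j
        · subst h
          rw [mul_right_comm, sgn_mul_self]
        · simp [h]
      have ho (e : ℤ) (he : e = j + 1 ∨ e = j - 1) (x : ℂ) :
          (-1 : ℂ) * (if (i : ℤ) = e then x else 0) = sgn ((l : ZMod 2) - ((i : ℤ) : ZMod 2) + p)
          * (if (i : ℤ) = e then x else 0) * sgn ((l : ZMod 2) - ((j : ℤ) : ZMod 2) + p) := by
        have h4 : sgn ((l : ZMod 2) - (e : ZMod 2) + p)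
            = -sgn ((l : ZMod 2) - ((j : ℤ) : ZMod 2) + p) := by
          rcases he with rfl | rfl
          · rw [← h3]; push_cast; ring_nf
          · rw [← h2]; push_cast; ring_nf
        split_ifs with h
        · rw [h, h4]
          linear_combination x * sgn_mul_self ((l : ZMod 2) - ((j : ℤ) : ZMod 2) + p)
        · simp
      have hm (M : Matrix (Wt l) (Wt l) ℂ) : (irrepPar l p * M * irrepPar l p) i j
          = sgn ((l : ZMod 2) - ((i : ℤ) : ZMod 2) + p) * M i j
            * sgn ((l : ZMod 2) - ((j : ℤ) : ZMod 2) + p) := by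
        simp only [irrepPar, Matrix.diagonal_mul, Matrix.mul_diagonal]
      rw [hm, liftUq_ug, Matrix.smul_apply, smul_eq_mul]
      cases g <;> simp only [irrepMat, Gen.deg, Matrix.of_apply, sgn_zero, sgn_one]
      · exact hd _
      · exact ho _ (Or.inl rfl) _
      · exact ho _ (Or.inr rfl) _
      · exact hd _
      · exact hd _

/-! ### Clebsch-Gordan coefficients -/

section ClebschGordan

variable (η : ℝ) (l₁ : ℕ) (p₁ : ZMod 2) (l₂ : ℕ) (p₂ : ZMod 2) (l : ℕ) (p : ZMod 2)

/-- The vectors `e_m = ∑ c(m₁, m₂, m) e_{m₁} ⊗ e_{m₂}` of `V^{l₁} ⊗ V^{l₂}`. -/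
def reducedVec {l₁ l₂ l : ℕ} (c : Wt l₁ → Wt l₂ → Wt l → ℝ) (m : Wt l) :
    Vsp l₁ ⊗[ℂ] Vsp l₂ :=
  ∑ m₁, ∑ m₂, (c m₁ m₂ m : ℂ) • (bv m₁ ⊗ₜ[ℂ] bv m₂)

/-- `c` is the array of Clebsch-Gordan coefficients of `V^l(p)` in `V^{l₁}(p₁) ⊗ V^{l₂}(p₂)`. -/
structure IsClebschGordan (c : Wt l₁ → Wt l₂ → Wt l → ℝ) : Prop where
  /-- The vectors `e_m` form the standard basis of a copy of `V^l(p)`: the map `e^l_m ↦ e_m` is an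
  (even) homomorphism of representations. -/
  hom : Fintype.linearCombination ℂ (reducedVec c) ∈
    intertwiners (irrep η l p) ((irrep η l₁ p₁).tensor (irrep η l₂ p₂)) 0
  /-- The highest weight vector is normalized for the pseudo-orthogonal form on the tensor product,
  in which `e_{m₁} ⊗ e_{m₂}` has square `(-1)^{(l₁ - m₁)(l₂ - m₂)}`. -/
  normalized : ∑ m₁ : Wt l₁, ∑ m₂ : Wt l₂,
    (-1 : ℝ) ^ (((l₁ : ℤ) - m₁) * ((l₂ : ℤ) - m₂)) * c m₁ m₂ (Wt.top l) ^ 2 = 1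
  /-- The phase: the coefficient of `e_{l₁} ⊗ e_{l - l₁}` in the highest weight vector is
  positive. -/
  phase : ∀ m₂ : Wt l₂, (l₁ : ℤ) + m₂ = l → 0 < c (Wt.top l₁) m₂ (Wt.top l)

open Classical in
/-- The Clebsch-Gordan coefficient `(l₁ m₁ p₁, l₂ m₂ p₂ | l m p)_q`.  It is zero if `V^l(p)` does
not occur in `V^{l₁}(p₁) ⊗ V^{l₂}(p₂)`. -/
def clebschGordan (m₁ : Wt l₁) (m₂ : Wt l₂) (m : Wt l) : ℝ :=
  if h : ∃ c, IsClebschGordan η l₁ p₁ l₂ p₂ l p c then h.choose m₁ m₂ m else 0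

/-- The modified Clebsch-Gordan coefficient `[l₁ m₁ p₁, l₂ m₂ p₂ | l m p]_q`. -/
def modClebschGordan (m₁ : Wt l₁) (m₂ : Wt l₂) (m : Wt l) : ℝ :=
  (-1) ^ (((l₁ : ℤ) - m₁) * ((l₂ : ℤ) - m₂)) * (-1) ^ (((l : ℤ) - m) * ((l₁ : ℤ) + l₂ + l)) *
    clebschGordan η l₁ p₁ l₂ p₂ l p m₁ m₂ m

end ClebschGordan

end QuantumOsp

end

/-!
A tensor operator `T` is determined by its matrix elements `t(m₁, m₂, m₃)`, which vanish unless
`m₃ = m₁ + m₂` because `T` commutes with `H`.  On these triples the hypothesis on the parities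
forces `T` to be even, so odd tensor operators are zero (`odd_tensorOperator_eq_zero`).

The matrix elements of an even `T` obey two recurrences, one for each of `v₊` and `v₋`.  In the
standard bases the matrix of `v₊` is, up to signs, the transpose of that of `v₋`; hence, after
multiplication by the signs that define the modified Clebsch-Gordan coefficients, the recurrences
become those for the coefficients of a homomorphism `V^{l₃} → V^{l₁} ⊗ V^{l₂}`
(`isHomArray_opCoeff`).  Such homomorphisms are unique up to a factor, since the highest weight
vector is determined by its coefficient at `e_{l₁} ⊗ e_{l₃ - l₁}` and `v₋` produces the other
vectors (`IsHomArray.eq_zero`).  This gives proportionality to the Clebsch-Gordan coefficients as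
soon as these exist.

If `T ≠ 0`, its own array provides them: it can be scaled to be real, and it remains to normalize
it, which needs the indefinite form `∑ (-1)^{(l₁ - m₁)(l₂ - m₂)} c(m₁, m₂, l₃)²` to be positive on
highest weight vectors (`IsHomArray.sum_sq_pos`).  With `N = l₁ + l₂ - l₃`, all signs are positive
for odd `N`.  For even `N` they alternate, and the sum is a terminating `q`-Chu-Vandermonde series
in base `-q`, which is a product with positive value (`alternating_sum_pos`).  If `T = 0`, the
reduced matrix element `0` will do.
-/

noncomputable section

namespace QuantumOsp

/-! ### The structure constants of the irreducible representations -/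

@[simp] theorem qnum_zero (η : ℝ) : qnum η 0 = 0 := by simp [qnum]

theorem qnum_ne_zero {η : ℝ} (hη : η ≠ 0) {n : ℤ} (hn : n ≠ 0) : qnum η n ≠ 0 := by
  rw [qnum, div_ne_zero_iff]
  refine ⟨?_, (qnum_den_pos η).ne'⟩
  rw [qpow_eq_exp, qpow_eq_exp]
  rcases Int.even_or_odd n with h | h
  · rw [h.neg_one_zpow, one_mul, sub_ne_zero, Ne, Real.exp_eq_exp]
    intro h'
    have : η * n = 0 := by linarith
    rcases mul_eq_zero.1 this with h | h
    · exact hη h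
    · exact hn (by exact_mod_cast h)
  · rw [h.neg_one_zpow, neg_one_mul, sub_neg_eq_add]
    positivity

theorem gam_ne_zero {η : ℝ} (hη : η ≠ 0) : gam η ≠ 0 := by
  rw [gam, div_ne_zero_iff, Ne, Ne, Real.sinh_eq_zero]
  exact ⟨(Real.cosh_pos _).ne', by simpa using hη⟩

theorem lowerCoeff_ne_zero {η : ℝ} (hη : η ≠ 0) {l : ℕ} {m : ℤ} (h1 : -l < m) (h2 : m ≤ l) :
    lowerCoeff η l m ≠ 0 := by
  rw [lowerCoeff, Real.sqrt_ne_zero']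
  refine lt_of_le_of_ne (qnum_prod_nonneg η (by omega) (by omega) ⟨l, by ring⟩) (Ne.symm ?_)
  exact mul_ne_zero (mul_ne_zero (qnum_ne_zero hη (by omega)) (qnum_ne_zero hη (by omega)))
    (gam_ne_zero hη)

theorem lowerCoeff_sq (η : ℝ) {l : ℕ} {m : ℤ} (h1 : -l ≤ m) (h2 : m ≤ l + 1) :
    lowerCoeff η l m ^ 2 = qnum η (l + m) * qnum η (l - m + 1) * gam η := by
  rw [lowerCoeff, Real.sq_sqrt (qnum_prod_nonneg η (by omega) (by omega) ⟨l, by ring⟩)]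

/-- The matrix of `v₊` is, up to signs, the transpose of that of `v₋`. -/
theorem raiseCoeff_eq (η : ℝ) (l : ℕ) (m : ℤ) :
    raiseCoeff η l m = (-1) ^ ((l : ℤ) - m) * lowerCoeff η l (m + 1) := by
  rw [raiseCoeff, lowerCoeff, show (l : ℤ) - (m + 1) + 1 = l - m by ring, ← add_assoc,
    mul_comm (qnum η (l - m))]

theorem raiseCoeff_ne_zero {η : ℝ} (hη : η ≠ 0) {l : ℕ} {m : ℤ} (h1 : -l ≤ m) (h2 : m < l) :
    raiseCoeff η l m ≠ 0 := by
  rw [raiseCoeff_eq]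
  exact mul_ne_zero (zpow_ne_zero _ (by norm_num)) (lowerCoeff_ne_zero hη (by omega) (by omega))

@[simp] theorem lowerCoeff_bot (η : ℝ) (l : ℕ) : lowerCoeff η l (-l) = 0 := by simp [lowerCoeff]

@[simp] theorem lowerCoeff_top (η : ℝ) (l : ℕ) : lowerCoeff η l (l + 1) = 0 := by
  simp [lowerCoeff]

@[simp] theorem raiseCoeff_top (η : ℝ) (l : ℕ) : raiseCoeff η l l = 0 := by simp [raiseCoeff_eq]

theorem raiseCoeff_bot (η : ℝ) (l : ℕ) : raiseCoeff η l (-l - 1) = 0 := by simp [raiseCoeff_eq]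

theorem qpow_pos (η x : ℝ) : 0 < qpow η x := by rw [qpow_eq_exp]; positivity

theorem qpow_zero (η : ℝ) : qpow η 0 = 1 := by simp [qpow_eq_exp]

theorem qpow_neg_mul (η x : ℝ) : qpow η (-x) * qpow η x = 1 := by
  rw [qpow_mul, neg_add_cancel, qpow_zero]

/-! ### Coordinates indexed by all integers -/

section Coordinates

variable {η : ℝ} {l : ℕ}

/-- The coordinate of index `m`, which is `0` unless `-l ≤ m ≤ l`. -/
def coord (l : ℕ) (m : ℤ) : Vsp l →ₗ[ℂ] ℂ :=
  if h : m ∈ Finset.Icc (-(l : ℤ)) l then LinearMap.proj ⟨m, h⟩ else 0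

/-- The basis vector `e_m`, which is `0` unless `-l ≤ m ≤ l`. -/
def bvZ (l : ℕ) (m : ℤ) : Vsp l :=
  if h : m ∈ Finset.Icc (-(l : ℤ)) l then bv ⟨m, h⟩ else 0

theorem coord_coe (m : Wt l) (v : Vsp l) : coord l m v = v m := by simp [coord]

theorem coord_of_notMem {m : ℤ} (h : m ∉ Finset.Icc (-(l : ℤ)) l) (v : Vsp l) :
    coord l m v = 0 := by
  rw [coord, dif_neg h]; rfl

theorem bvZ_coe (m : Wt l) : bvZ l m = bv m := by simp [bvZ]

theorem bvZ_of_notMem {m : ℤ} (h : m ∉ Finset.Icc (-(l : ℤ)) l) : bvZ l m = 0 := dif_neg h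

theorem coord_ext {v w : Vsp l} (h : ∀ m, coord l m v = coord l m w) : v = w := by
  funext m
  rw [← coord_coe m v, h, coord_coe]

theorem coord_bvZ {m' m : ℤ} (h : m ∈ Finset.Icc (-(l : ℤ)) l) :
    coord l m' (bvZ l m) = if m' = m then 1 else 0 := by
  by_cases h' : m' ∈ Finset.Icc (-(l : ℤ)) l
  · rw [show coord l m' = coord l ((⟨m', h'⟩ : Wt l) : ℤ) from rfl, coord_coe, bvZ, dif_pos h, bv]
    simp [Pi.single_apply]
  · rw [coord_of_notMem h', if_neg]
    rintro rfl
    exact h' h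

theorem irrep_act_apply (p : ZMod 2) (g : Gen) (v : Vsp l) (m : Wt l) :
    (irrep η l p).act (ug η g) v m = ∑ x, irrepMat η l g m x * v x := by
  have : (irrep η l p).act (ug η g) = Matrix.toLin' (irrepMat η l g) := by
    simp only [irrep, AlgHom.comp_apply, liftUq_ug]
    rfl
  rw [this, Matrix.toLin'_apply]
  rfl

theorem coord_par (p : ZMod 2) (m : ℤ) (v : Vsp l) :
    coord l m ((irrep η l p).par v) = sgn ((l : ZMod 2) - (m : ZMod 2) + p) * coord l m v := by
  by_cases h : m ∈ Finset.Icc (-(l : ℤ)) l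
  · lift m to Wt l using h
    have : (irrep η l p).par = Matrix.toLin' (irrepPar l p) := rfl
    rw [coord_coe, coord_coe, this, Matrix.toLin'_apply, irrepPar, Matrix.mulVec_diagonal]
  · simp [coord_of_notMem h]

theorem coord_act_diagonal (p : ZMod 2) {g : Gen} {f : ℤ → ℂ}
    (hf : irrepMat η l g = Matrix.diagonal fun m : Wt l => f (m : ℤ)) (m : ℤ) (v : Vsp l) :
    coord l m ((irrep η l p).act (ug η g) v) = f m * coord l m v := by
  by_cases h : m ∈ Finset.Icc (-(l : ℤ)) l
  · lift m to Wt l using h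
    rw [coord_coe, coord_coe, irrep_act_apply, hf]
    simp [Matrix.diagonal_apply]
  · simp [coord_of_notMem h]

theorem coord_act_H (p : ZMod 2) (m : ℤ) (v : Vsp l) :
    coord l m ((irrep η l p).act (ug η .H) v) = (m / 2 : ℂ) * coord l m v :=
  coord_act_diagonal p (f := fun m => (m / 2 : ℂ)) rfl m v

theorem coord_act_K (p : ZMod 2) (m : ℤ) (v : Vsp l) :
    coord l m ((irrep η l p).act (ug η .K) v) = (qpow η (m / 2) : ℂ) * coord l m v :=
  coord_act_diagonal p (f := fun m => (qpow η (m / 2) : ℂ)) rfl m v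

theorem coord_act_Kinv (p : ZMod 2) (m : ℤ) (v : Vsp l) :
    coord l m ((irrep η l p).act (ug η .Kinv) v) = (qpow η (-m / 2) : ℂ) * coord l m v :=
  coord_act_diagonal p (f := fun m => (qpow η (-m / 2) : ℂ)) rfl m v

/-- This holds for every integer `m`, because `lowerCoeff` vanishes at `-l` and at `l + 1`. -/
theorem coord_act_vm (p : ZMod 2) (m : ℤ) (v : Vsp l) :
    coord l m ((irrep η l p).act (ug η .vm) v)
      = (lowerCoeff η l (m + 1) : ℂ) * coord l (m + 1) v := by
  by_cases h : m ∈ Finset.Icc (-(l : ℤ)) l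
  · lift m to Wt l using h
    rw [coord_coe, irrep_act_apply]
    by_cases h' : (m : ℤ) + 1 ∈ Finset.Icc (-(l : ℤ)) l
    · rw [Finset.sum_eq_single (⟨m + 1, h'⟩ : Wt l), ← coord_coe _ v]
      · simp [irrepMat, Matrix.of_apply]
      · intro b _ hb
        have : (m : ℤ) ≠ b - 1 := fun hh => hb (Subtype.ext (by simp [hh]))
        simp [irrepMat, this]
      · simp
    · rw [coord_of_notMem h', mul_zero]
      apply Finset.sum_eq_zero
      intro b _
      have : (m : ℤ) ≠ b - 1 := fun hh => h' (by rw [hh]; simp)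
      simp [irrepMat, this]
  · rw [coord_of_notMem h]
    by_cases h' : m + 1 ∈ Finset.Icc (-(l : ℤ)) l
    · have : m + 1 = -l := by simp only [Finset.mem_Icc] at h h'; omega
      simp [this]
    · simp [coord_of_notMem h']

theorem coord_act_vp (p : ZMod 2) (m : ℤ) (v : Vsp l) :
    coord l m ((irrep η l p).act (ug η .vp) v)
      = (raiseCoeff η l (m - 1) : ℂ) * coord l (m - 1) v := by
  by_cases h : m ∈ Finset.Icc (-(l : ℤ)) l
  · lift m to Wt l using h
    rw [coord_coe, irrep_act_apply]
    by_cases h' : (m : ℤ) - 1 ∈ Finset.Icc (-(l : ℤ)) l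
    · rw [Finset.sum_eq_single (⟨m - 1, h'⟩ : Wt l), ← coord_coe _ v]
      · simp [irrepMat, Matrix.of_apply]
      · intro b _ hb
        have : (m : ℤ) ≠ b + 1 := fun hh => hb (Subtype.ext (by simp [hh]))
        simp [irrepMat, this]
      · simp
    · rw [coord_of_notMem h', mul_zero]
      apply Finset.sum_eq_zero
      intro b _
      have : (m : ℤ) ≠ b + 1 := fun hh => h' (by rw [hh]; simp)
      simp [irrepMat, this]
  · rw [coord_of_notMem h]
    by_cases h' : m - 1 ∈ Finset.Icc (-(l : ℤ)) l
    · have : m - 1 = l := by simp only [Finset.mem_Icc] at h h'; omega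
      simp [this]
    · simp [coord_of_notMem h']

theorem par_bvZ (p : ZMod 2) (m : ℤ) :
    (irrep η l p).par (bvZ l m) = sgn ((l : ZMod 2) - (m : ZMod 2) + p) • bvZ l m := by
  by_cases h : m ∈ Finset.Icc (-(l : ℤ)) l
  · apply coord_ext
    intro m'
    rw [coord_par, map_smul, smul_eq_mul, coord_bvZ h]
    split_ifs with h'
    · rw [h']
    · simp
  · simp [bvZ_of_notMem h]

theorem act_bvZ_diagonal (p : ZMod 2) {g : Gen} {f : ℤ → ℂ}
    (hf : ∀ m v, coord l m ((irrep η l p).act (ug η g) v) = f m * coord l m v) (m : ℤ) :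
    (irrep η l p).act (ug η g) (bvZ l m) = f m • bvZ l m := by
  by_cases h : m ∈ Finset.Icc (-(l : ℤ)) l
  · apply coord_ext
    intro m'
    rw [hf, map_smul, smul_eq_mul, coord_bvZ h]
    split_ifs with h'
    · rw [h']
    · simp
  · simp [bvZ_of_notMem h]

theorem act_H_bvZ (p : ZMod 2) (m : ℤ) :
    (irrep η l p).act (ug η .H) (bvZ l m) = (m / 2 : ℂ) • bvZ l m :=
  act_bvZ_diagonal p (f := fun m => (m / 2 : ℂ)) (coord_act_H p) m

theorem act_K_bvZ (p : ZMod 2) (m : ℤ) :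
    (irrep η l p).act (ug η .K) (bvZ l m) = (qpow η (m / 2) : ℂ) • bvZ l m :=
  act_bvZ_diagonal p (f := fun m => (qpow η (m / 2) : ℂ)) (coord_act_K p) m

theorem act_Kinv_bvZ (p : ZMod 2) (m : ℤ) :
    (irrep η l p).act (ug η .Kinv) (bvZ l m) = (qpow η (-m / 2) : ℂ) • bvZ l m :=
  act_bvZ_diagonal p (f := fun m => (qpow η (-m / 2) : ℂ)) (coord_act_Kinv p) m

theorem act_vm_bvZ (p : ZMod 2) (m : ℤ) :
    (irrep η l p).act (ug η .vm) (bvZ l m) = (lowerCoeff η l m : ℂ) • bvZ l (m - 1) := by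
  by_cases h : m ∈ Finset.Icc (-(l : ℤ)) l
  · apply coord_ext
    intro m'
    rw [coord_act_vm, map_smul, smul_eq_mul, coord_bvZ h]
    by_cases h' : m - 1 ∈ Finset.Icc (-(l : ℤ)) l
    · rw [coord_bvZ h']
      by_cases hm : m' + 1 = m
      · rw [if_pos hm, if_pos (by omega), hm]
      · rw [if_neg hm, if_neg (by omega)]; simp
    · have : m = -l := by simp only [Finset.mem_Icc] at h h'; omega
      rw [bvZ_of_notMem h']
      split_ifs with hm
      · rw [hm, this]; simp
      · simp
  · rw [bvZ_of_notMem h]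
    by_cases h' : m - 1 ∈ Finset.Icc (-(l : ℤ)) l
    · have : m = l + 1 := by simp only [Finset.mem_Icc] at h h'; omega
      simp [this]
    · simp [bvZ_of_notMem h']

theorem act_vp_bvZ (p : ZMod 2) (m : ℤ) :
    (irrep η l p).act (ug η .vp) (bvZ l m) = (raiseCoeff η l m : ℂ) • bvZ l (m + 1) := by
  by_cases h : m ∈ Finset.Icc (-(l : ℤ)) l
  · apply coord_ext
    intro m'
    rw [coord_act_vp, map_smul, smul_eq_mul, coord_bvZ h]
    by_cases h' : m + 1 ∈ Finset.Icc (-(l : ℤ)) l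
    · rw [coord_bvZ h']
      by_cases hm : m' - 1 = m
      · rw [if_pos hm, if_pos (by omega), hm]
      · rw [if_neg hm, if_neg (by omega)]; simp
    · have : m = l := by simp only [Finset.mem_Icc] at h h'; omega
      rw [bvZ_of_notMem h']
      split_ifs with hm
      · rw [hm, this]; simp
      · simp
  · rw [bvZ_of_notMem h]
    by_cases h' : m + 1 ∈ Finset.Icc (-(l : ℤ)) l
    · have : m = -l - 1 := by simp only [Finset.mem_Icc] at h h'; omega
      simp [this, raiseCoeff_bot]
    · simp [bvZ_of_notMem h']

/-- The coordinate of index `(m₁, m₂)` in `V^{l₁} ⊗ V^{l₂}`. -/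
def tcoord (l₁ l₂ : ℕ) (m₁ m₂ : ℤ) : Vsp l₁ ⊗[ℂ] Vsp l₂ →ₗ[ℂ] ℂ :=
  LinearMap.mul' ℂ ℂ ∘ₗ TensorProduct.map (coord l₁ m₁) (coord l₂ m₂)

@[simp] theorem tcoord_tmul {l₁ l₂ : ℕ} (m₁ m₂ : ℤ) (v : Vsp l₁) (w : Vsp l₂) :
    tcoord l₁ l₂ m₁ m₂ (v ⊗ₜ[ℂ] w) = coord l₁ m₁ v * coord l₂ m₂ w := rfl

theorem tcoord_ext {l₁ l₂ : ℕ} {x y : Vsp l₁ ⊗[ℂ] Vsp l₂}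
    (h : ∀ (m₁ : Wt l₁) (m₂ : Wt l₂), tcoord l₁ l₂ m₁ m₂ x = tcoord l₁ l₂ m₁ m₂ y) : x = y := by
  apply ((Pi.basisFun ℂ (Wt l₁)).tensorProduct (Pi.basisFun ℂ (Wt l₂))).ext_elem
  rintro ⟨m₁, m₂⟩
  have key (z : Vsp l₁ ⊗[ℂ] Vsp l₂) :
      ((Pi.basisFun ℂ (Wt l₁)).tensorProduct (Pi.basisFun ℂ (Wt l₂))).repr z (m₁, m₂)
        = tcoord l₁ l₂ m₁ m₂ z := by
    induction z using TensorProduct.induction_on with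
    | zero => simp
    | tmul v w => simp [coord_coe, mul_comm]
    | add x y hx hy => simp [hx, hy]
  rw [key, key, h]

end Coordinates

/-! ### A `q`-Chu-Vandermonde sum and its positivity -/

/-- The Gaussian binomial coefficient, by the Pascal recursion
`[N+1, k+1] = [N, k] + Q^(k+1) [N, k+1]`. -/
def gaussBinom (Q : ℝ) : ℕ → ℕ → ℝ
  | _, 0 => 1
  | 0, _ + 1 => 0
  | N + 1, k + 1 => gaussBinom Q N k + Q ^ (k + 1) * gaussBinom Q N (k + 1)

theorem gaussBinom_zero_right (Q : ℝ) (N : ℕ) : gaussBinom Q N 0 = 1 := by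
  cases N <;> rfl

theorem gaussBinom_eq_zero (Q : ℝ) {N k : ℕ} (h : N < k) : gaussBinom Q N k = 0 := by
  induction N generalizing k with
  | zero =>
    obtain ⟨k, rfl⟩ := Nat.exists_eq_succ_of_ne_zero h.ne'
    rfl
  | succ N ih =>
    obtain ⟨k, rfl⟩ := Nat.exists_eq_succ_of_ne_zero (Nat.ne_zero_of_lt h)
    rw [Nat.succ_eq_add_one, gaussBinom, ih (by omega), ih (by omega)]
    simp

theorem gaussBinom_succ_mul (Q : ℝ) {N k : ℕ} (h : k ≤ N) :
    gaussBinom Q N (k + 1) * (1 - Q ^ (k + 1)) = gaussBinom Q N k * (1 - Q ^ (N - k)) := by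
  induction N generalizing k with
  | zero =>
    obtain rfl : k = 0 := by omega
    simp [gaussBinom]
  | succ N ih =>
    have top : gaussBinom Q (N + 1) (k + 1) * (1 - Q ^ (k + 1))
        = gaussBinom Q N k * (1 - Q ^ (N + 1)) := by
      rcases Nat.lt_or_ge N k with hk | hk
      · rw [gaussBinom_eq_zero Q (by omega), gaussBinom_eq_zero Q hk]; simp
      · have hp : Q ^ (N + 1) = Q ^ (k + 1) * Q ^ (N - k) := by rw [← pow_add]; congr 1; omega
        rw [gaussBinom, hp]
        linear_combination Q ^ (k + 1) * ih hk
    rw [top]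
    cases k with
    | zero => simp [gaussBinom_zero_right]
    | succ j =>
      have hp : Q ^ (N + 1) = Q ^ (j + 1) * Q ^ (N - j) := by rw [← pow_add]; congr 1; omega
      rw [gaussBinom, Nat.add_sub_add_right, hp]
      linear_combination ih (k := j) (by omega)

open Finset in
/-- The `q`-Chu-Vandermonde summation, cleared of denominators.  Both sides acquire the factor
`1 - a` when `(N, a)` is replaced by `(N + 1, a)` and the old `a` by `a Q`. -/
theorem q_chu_vandermonde (Q a b : ℝ) (N : ℕ) :
    ∑ k ∈ range (N + 1), gaussBinom Q N k *
        ((∏ j ∈ range k, ((1 - b * Q ^ j) * (-(a * Q ^ j)))) *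
          ∏ j ∈ range (N - k), (1 - a * b * Q ^ (k + j)))
      = ∏ j ∈ range N, (1 - a * Q ^ j) := by
  induction N generalizing a with
  | zero => simp [gaussBinom]
  | succ N ih =>
    rw [prod_range_succ']
    have hr : ∏ j ∈ range N, (1 - a * Q ^ (j + 1)) = ∏ j ∈ range N, (1 - a * Q * Q ^ j) :=
      prod_congr rfl fun j _ => by ring
    rw [hr, ← ih, sum_mul]
    set f : ℕ → ℝ := fun k => (∏ j ∈ range k, ((1 - b * Q ^ j) * (-(a * Q ^ j)))) *
        ∏ j ∈ range (N + 1 - k), (1 - a * b * Q ^ (k + j)) with hf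
    have hpascal : ∑ k ∈ range (N + 1 + 1), gaussBinom Q (N + 1) k * f k
        = ∑ k ∈ range (N + 1), gaussBinom Q N k * (Q ^ k * f k + f (k + 1)) := by
      have h1 : ∑ k ∈ range (N + 1 + 1), gaussBinom Q N k * (Q ^ k * f k)
          = ∑ k ∈ range (N + 1), gaussBinom Q N k * (Q ^ k * f k) := by
        rw [sum_range_succ, gaussBinom_eq_zero Q (Nat.lt_succ_self N)]; simp
      simp only [mul_add]
      rw [sum_add_distrib, ← h1, sum_range_succ', sum_range_succ' _ (N + 1), add_right_comm,
        ← sum_add_distrib]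
      congr 1
      · refine sum_congr rfl fun k _ => ?_
        rw [gaussBinom]; ring
      · simp [gaussBinom_zero_right]
    refine hpascal.trans ?_
    refine sum_congr rfl fun k hk => ?_
    have hk' : N + 1 - k = (N - k) + 1 := by have := mem_range.1 hk; omega
    have hP : ∏ j ∈ range k, ((1 - b * Q ^ j) * (-(a * Q * Q ^ j)))
        = Q ^ k * ∏ j ∈ range k, ((1 - b * Q ^ j) * (-(a * Q ^ j))) := by
      rw [← card_range k, ← prod_const, card_range, ← prod_mul_distrib]
      exact prod_congr rfl fun j _ => by ring
    have hR : ∏ j ∈ range (N - k), (1 - a * Q * b * Q ^ (k + j))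
        = ∏ j ∈ range (N - k), (1 - a * b * Q ^ (k + (j + 1))) :=
      prod_congr rfl fun j _ => by ring
    have hR' : ∏ j ∈ range (N - k), (1 - a * b * Q ^ (k + 1 + j))
        = ∏ j ∈ range (N - k), (1 - a * b * Q ^ (k + (j + 1))) :=
      prod_congr rfl fun j _ => by ring
    simp only [hf]
    rw [hP, hR, hk', Nat.add_sub_add_right, hR', prod_range_succ _ k, prod_range_succ' _ (N - k)]
    simp only [add_zero, pow_zero, mul_one]
    ring

open Finset in
/-- The sum of a sequence with the term ratio of a terminating `₂φ₁` series at the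
Chu-Vandermonde argument. -/
theorem sum_mul_prod_of_rec {Q a b : ℝ} {N : ℕ} {u : ℕ → ℝ}
    (hu : ∀ k < N, u (k + 1) * ((1 - Q ^ (k + 1)) * (1 - a * b * Q ^ k))
      = u k * ((1 - Q ^ (N - k)) * ((1 - b * Q ^ k) * (-(a * Q ^ k)))))
    (hQ : ∀ k < N, 1 - Q ^ (k + 1) ≠ 0) :
    (∑ k ∈ range (N + 1), u k) * ∏ j ∈ range N, (1 - a * b * Q ^ j)
      = u 0 * ∏ j ∈ range N, (1 - a * Q ^ j) := by
  have key : ∀ k ≤ N, u k * ∏ j ∈ range k, (1 - a * b * Q ^ j)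
      = u 0 * (gaussBinom Q N k * ∏ j ∈ range k, ((1 - b * Q ^ j) * (-(a * Q ^ j)))) := by
    intro k
    induction k with
    | zero => simp [gaussBinom_zero_right]
    | succ k ih =>
      intro hk
      apply mul_right_cancel₀ (hQ k (by omega))
      have h1 := gaussBinom_succ_mul Q (show k ≤ N by omega)
      rw [prod_range_succ, prod_range_succ]
      linear_combination (∏ j ∈ range k, (1 - a * b * Q ^ j)) * hu k (by omega)
        + (1 - Q ^ (N - k)) * ((1 - b * Q ^ k) * (-(a * Q ^ k))) * ih (by omega)
        - u 0 * (∏ j ∈ range k, ((1 - b * Q ^ j) * (-(a * Q ^ j)))) *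
          ((1 - b * Q ^ k) * (-(a * Q ^ k))) * h1
  rw [← q_chu_vandermonde Q a b N, sum_mul, mul_sum]
  refine sum_congr rfl fun k hk => ?_
  have hk' : k ≤ N := by have := mem_range.1 hk; omega
  have hs : ∏ j ∈ range N, (1 - a * b * Q ^ j) = (∏ j ∈ range k, (1 - a * b * Q ^ j)) *
      ∏ j ∈ range (N - k), (1 - a * b * Q ^ (k + j)) := by
    rw [← prod_range_add, Nat.add_sub_cancel' hk']
  rw [hs, ← mul_assoc, key k hk']
  ring

theorem one_sub_pow_mul_pos {x : ℝ} (hx : x < 0) (hx1 : x ≠ -1) {r s : ℕ} (hr : 0 < r)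
    (hs : 0 < s) (hrs : Even (r + s)) : 0 < (1 - x ^ r) * (1 - x ^ s) := by
  rcases Nat.even_or_odd r with h | h
  · have h' : Even s := (Nat.even_add.1 hrs).1 h
    rw [← h.neg_pow x, ← h'.neg_pow x]
    rcases lt_or_gt_of_ne (show -x ≠ 1 by contrapose! hx1; linarith) with h1 | h1
    · have a1 := pow_lt_one₀ (by linarith) h1 hr.ne'
      have a2 := pow_lt_one₀ (by linarith) h1 hs.ne'
      exact mul_pos (by linarith) (by linarith)
    · have a1 := one_lt_pow₀ h1 hr.ne'
      have a2 := one_lt_pow₀ h1 hs.ne'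
      exact mul_pos_of_neg_of_neg (by linarith) (by linarith)
  · have h' : Odd s := by
      rw [← Nat.not_even_iff_odd] at h ⊢
      exact fun h' => h ((Nat.even_add.1 hrs).2 h')
    have a1 := h.pow_neg hx
    have a2 := h'.pow_neg hx
    exact mul_pos (by linarith) (by linarith)

open Finset in
/-- The two products in the Chu-Vandermonde sum have the same sign: their factors match up in
pairs of equal parity. -/
theorem prod_one_sub_pow_mul_pos {x : ℝ} (hx : x < 0) (hx1 : x ≠ -1) {L M n : ℕ} (hL : Even L)
    (hM : Even M) (hnL : 2 * n ≤ L) (hnM : 2 * n ≤ M) :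
    0 < (∏ j ∈ range (2 * n), (1 - x ^ (L + 1 - j))) * ∏ j ∈ range (2 * n), (1 - x ^ (M - j)) := by
  induction n with
  | zero => simp
  | succ n ih =>
    have h1 := one_sub_pow_mul_pos hx hx1 (r := L + 1 - 2 * n) (s := M - (2 * n + 1)) (by omega)
      (by omega) (by obtain ⟨l, rfl⟩ := hL; obtain ⟨m, rfl⟩ := hM; exact ⟨l + m - 2 * n, by omega⟩)
    have h2 := one_sub_pow_mul_pos hx hx1 (r := L + 1 - (2 * n + 1)) (s := M - 2 * n) (by omega)
      (by omega) (by obtain ⟨l, rfl⟩ := hL; obtain ⟨m, rfl⟩ := hM; exact ⟨l + m - 2 * n, by omega⟩)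
    have h3 := mul_pos (ih (by omega) (by omega)) (mul_pos h1 h2)
    rw [show 2 * (n + 1) = 2 * n + 1 + 1 by ring]
    simp only [prod_range_succ]
    refine lt_of_lt_of_eq h3 ?_
    ring

open Finset in
/-- The alternating sum of a sequence whose term ratio is that of the squares of the
Clebsch-Gordan coefficients of a highest weight vector. -/
theorem alternating_sum_pos {q : ℝ} (hq : 0 < q) (hq1 : q ≠ 1) {M N B : ℕ} (hN : Even N)
    (hM : Even M) (hB : Even B) (hNM : N ≤ M) {w : ℕ → ℝ} (hw : 0 < w 0)
    (hrec : ∀ i < N, w (i + 1) * q ^ (B + 1) * ((1 - (-q) ^ (i + 1)) * (1 - (-q) ^ (M - i)))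
      = (1 - (-q) ^ (N - i)) * (1 - (-q) ^ (B + 1 + i)) * w i) :
    0 < ∑ i ∈ range (N + 1), (-1) ^ i * w i := by
  obtain ⟨Q, hQ⟩ : ∃ Q, -q = Q := ⟨_, rfl⟩
  obtain rfl : q = -Q := by linarith
  rw [neg_neg] at hrec
  have hQ0 : Q < 0 := by linarith
  have hQ1 : Q ≠ -1 := by contrapose! hq1; linarith
  obtain ⟨x, hx⟩ : ∃ x, Q⁻¹ = x := ⟨_, rfl⟩
  have hx0 : x < 0 := hx ▸ inv_lt_zero.2 hQ0
  have hx1 : x ≠ -1 := by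
    rintro rfl
    apply hQ1
    rw [← inv_inv Q, hx]; norm_num
  have hxQ : x * Q = 1 := by rw [← hx, inv_mul_cancel₀ hQ0.ne]
  have hpow {m k : ℕ} (h : k ≤ m) : x ^ m * Q ^ k = x ^ (m - k) := by
    rw [← Nat.sub_add_cancel h, pow_add, mul_assoc, ← mul_pow, hxQ]; simp
  have hpow' {m k : ℕ} (h : k ≤ m) : x ^ k * Q ^ m = Q ^ (m - k) := by
    rw [← Nat.sub_add_cancel h, pow_add Q, mul_left_comm, ← mul_pow, hxQ]; simp
  have hne (k : ℕ) : 1 - Q ^ (k + 1) ≠ 0 := fun h0 => by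
    have := one_sub_pow_mul_pos hQ0 hQ1 (Nat.succ_pos k) (Nat.succ_pos k) ⟨_, rfl⟩
    simp [h0] at this
  have hab : x ^ (M + B + 1) * Q ^ (B + 1) = x ^ M := by rw [hpow (by omega)]; congr 1; omega
  -- The base is `Q = -q`, and the parameters are `a = Q^{-(M+B+1)}`, `b = Q^{B+1}`.
  have hsum := sum_mul_prod_of_rec (Q := Q) (a := x ^ (M + B + 1)) (b := Q ^ (B + 1)) (N := N)
    (u := fun i => (-1) ^ i * w i) (fun k hk => by
      have h1 := hrec k hk
      have h2 : Q ^ (B + 1 + k) = Q ^ (B + 1) * Q ^ k := pow_add _ _ _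
      have hs : (-Q) ^ (B + 1) = -Q ^ (B + 1) := Odd.neg_pow hB.add_one Q
      rw [h2, hs] at h1
      have h3 : x ^ (M - k) * Q ^ (M - k) = 1 := by rw [← mul_pow, hxQ, one_pow]
      have h5 : x ^ (M + B + 1) * Q ^ k = x ^ (M - k) * x ^ (B + 1) := by
        rw [hpow (by omega), ← pow_add]; congr 1; omega
      have h6 : x ^ (B + 1) * Q ^ (B + 1) = 1 := by rw [← mul_pow, hxQ, one_pow]
      rw [hab, hpow (by omega), h5, pow_succ (-1 : ℝ)]
      linear_combination (-(-1 : ℝ) ^ k * x ^ (M - k) * x ^ (B + 1)) * h1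
        + (-1 : ℝ) ^ k * w (k + 1) * (1 - Q ^ (k + 1)) *
          (h3 - (x ^ (M - k) - x ^ (M - k) * Q ^ (M - k)) * h6)) (fun k _ => hne k)
  have hpos := prod_one_sub_pow_mul_pos hx0 hx1 (L := M + B) (M := M) (n := N / 2) (hM.add hB) hM
    (by omega) (by omega)
  rw [Nat.two_mul_div_two_of_even hN] at hpos
  rw [hab] at hsum
  have e1 : ∏ j ∈ range N, (1 - x ^ (M + B + 1) * Q ^ j) = ∏ j ∈ range N, (1 - x ^ (M + B + 1 - j)) :=
    prod_congr rfl fun j hj => by rw [hpow]; have := mem_range.1 hj; omega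
  have e2 : ∏ j ∈ range N, (1 - x ^ M * Q ^ j) = ∏ j ∈ range N, (1 - x ^ (M - j)) :=
    prod_congr rfl fun j hj => by rw [hpow]; have := mem_range.1 hj; omega
  rw [e1, e2] at hsum
  simp only [pow_zero, one_mul] at hsum
  refine pos_of_mul_pos_left (b := (∏ j ∈ range N, (1 - x ^ (M - j))) ^ 2) ?_ (sq_nonneg _)
  rw [pow_two, ← mul_assoc, hsum, mul_assoc]
  exact mul_pos hw hpos

/-! ### Arrays of coefficients of homomorphisms `V^{l₃} → V^{l₁} ⊗ V^{l₂}` -/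

/-- The array `c`, indexed by all integers and zero outside the ranges of the weights, satisfies
the recurrences which say that `e_{m₃} ↦ ∑ c(m₁, m₂, m₃) e_{m₁} ⊗ e_{m₂}` commutes with `H`, `v₋`
and `v₊`.  The parity of `V^{l₁}` enters through the sign in the coproduct action, while those of
`V^{l₂}` and `V^{l₃}` do not. -/
structure IsHomArray (η : ℝ) (l₁ : ℕ) (p₁ : ZMod 2) (l₂ l₃ : ℕ) (c : ℤ → ℤ → ℤ → ℂ) : Prop where
  range₁ : ∀ {m₁ : ℤ}, m₁ ∉ Finset.Icc (-(l₁ : ℤ)) l₁ → ∀ m₂ m₃, c m₁ m₂ m₃ = 0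
  range₂ : ∀ {m₂ : ℤ}, m₂ ∉ Finset.Icc (-(l₂ : ℤ)) l₂ → ∀ m₁ m₃, c m₁ m₂ m₃ = 0
  range₃ : ∀ {m₃ : ℤ}, m₃ ∉ Finset.Icc (-(l₃ : ℤ)) l₃ → ∀ m₁ m₂, c m₁ m₂ m₃ = 0
  weight : ∀ {m₁ m₂ m₃ : ℤ}, m₃ ≠ m₁ + m₂ → c m₁ m₂ m₃ = 0
  lower : ∀ m₁ m₂ m₃ : ℤ, (lowerCoeff η l₃ m₃ : ℂ) * c m₁ m₂ (m₃ - 1)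
    = (qpow η (m₂ / 2) : ℂ) * lowerCoeff η l₁ (m₁ + 1) * c (m₁ + 1) m₂ m₃
      + sgn ((l₁ : ZMod 2) - (m₁ : ZMod 2) + p₁) * (qpow η (-m₁ / 2) : ℂ)
        * lowerCoeff η l₂ (m₂ + 1) * c m₁ (m₂ + 1) m₃
  raise : ∀ m₁ m₂ m₃ : ℤ, (raiseCoeff η l₃ m₃ : ℂ) * c m₁ m₂ (m₃ + 1)
    = (qpow η (m₂ / 2) : ℂ) * raiseCoeff η l₁ (m₁ - 1) * c (m₁ - 1) m₂ m₃
      + sgn ((l₁ : ZMod 2) - (m₁ : ZMod 2) + p₁) * (qpow η (-m₁ / 2) : ℂ)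
        * raiseCoeff η l₂ (m₂ - 1) * c m₁ (m₂ - 1) m₃

theorem ofReal_qpow_ne_zero (η x : ℝ) : (qpow η x : ℂ) ≠ 0 :=
  Complex.ofReal_ne_zero.2 (qpow_pos η x).ne'

theorem sgn_re (i : ZMod 2) : sgn i = ((sgn i).re : ℂ) := by
  rcases zmod2_cases i with rfl | rfl <;> simp

namespace IsHomArray

variable {η : ℝ} {l₁ l₂ l₃ : ℕ} {p₁ : ZMod 2} {c c' : ℤ → ℤ → ℤ → ℂ}

theorem sub (h : IsHomArray η l₁ p₁ l₂ l₃ c) (h' : IsHomArray η l₁ p₁ l₂ l₃ c') :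
    IsHomArray η l₁ p₁ l₂ l₃ fun m₁ m₂ m₃ => c m₁ m₂ m₃ - c' m₁ m₂ m₃ where
  range₁ hm _ _ := by rw [h.range₁ hm, h'.range₁ hm, sub_zero]
  range₂ hm _ _ := by rw [h.range₂ hm, h'.range₂ hm, sub_zero]
  range₃ hm _ _ := by rw [h.range₃ hm, h'.range₃ hm, sub_zero]
  weight hm := by rw [h.weight hm, h'.weight hm, sub_zero]
  lower m₁ m₂ m₃ := by linear_combination h.lower m₁ m₂ m₃ - h'.lower m₁ m₂ m₃
  raise m₁ m₂ m₃ := by linear_combination h.raise m₁ m₂ m₃ - h'.raise m₁ m₂ m₃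

theorem smul (h : IsHomArray η l₁ p₁ l₂ l₃ c) (a : ℂ) :
    IsHomArray η l₁ p₁ l₂ l₃ fun m₁ m₂ m₃ => a * c m₁ m₂ m₃ where
  range₁ hm _ _ := by rw [h.range₁ hm, mul_zero]
  range₂ hm _ _ := by rw [h.range₂ hm, mul_zero]
  range₃ hm _ _ := by rw [h.range₃ hm, mul_zero]
  weight hm := by rw [h.weight hm, mul_zero]
  lower m₁ m₂ m₃ := by linear_combination a * h.lower m₁ m₂ m₃
  raise m₁ m₂ m₃ := by linear_combination a * h.raise m₁ m₂ m₃

/-- The structure constants are real, so the real parts form again such an array. -/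
theorem re (h : IsHomArray η l₁ p₁ l₂ l₃ c) :
    IsHomArray η l₁ p₁ l₂ l₃ fun m₁ m₂ m₃ => ((c m₁ m₂ m₃).re : ℂ) where
  range₁ hm _ _ := by simp [h.range₁ hm]
  range₂ hm _ _ := by simp [h.range₂ hm]
  range₃ hm _ _ := by simp [h.range₃ hm]
  weight hm := by simp [h.weight hm]
  lower m₁ m₂ m₃ := by
    have := congrArg Complex.re (h.lower m₁ m₂ m₃)
    rw [sgn_re] at this ⊢
    simp only [← Complex.ofReal_mul, Complex.add_re, Complex.re_ofReal_mul] at this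
    exact_mod_cast this
  raise m₁ m₂ m₃ := by
    have := congrArg Complex.re (h.raise m₁ m₂ m₃)
    rw [sgn_re] at this ⊢
    simp only [← Complex.ofReal_mul, Complex.add_re, Complex.re_ofReal_mul] at this
    exact_mod_cast this

/-- The highest weight condition along the line `m₁ + m₂ = l₃`. -/
theorem raise_top (h : IsHomArray η l₁ p₁ l₂ l₃ c) (m₁ m₂ : ℤ) :
    (qpow η (m₂ / 2) : ℂ) * raiseCoeff η l₁ (m₁ - 1) * c (m₁ - 1) m₂ l₃
      + sgn ((l₁ : ZMod 2) - (m₁ : ZMod 2) + p₁) * (qpow η (-m₁ / 2) : ℂ)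
        * raiseCoeff η l₂ (m₂ - 1) * c m₁ (m₂ - 1) l₃ = 0 := by
  rw [← h.raise m₁ m₂ l₃]
  simp

/-- Uniqueness of homomorphisms up to a factor: the coefficient of `e_{l₁} ⊗ e_{l₃ - l₁}` in the
highest weight vector determines the array.  The highest weight condition recovers the highest
weight vector from it, and `v₋` the other vectors. -/
theorem eq_zero (hη : η ≠ 0) (h : IsHomArray η l₁ p₁ l₂ l₃ c) (h0 : c l₁ (l₃ - l₁) l₃ = 0)
    (m₁ m₂ m₃ : ℤ) : c m₁ m₂ m₃ = 0 := by
  have step (i : ℕ) : c (l₁ - i) (l₃ - l₁ + i) l₃ = 0 := by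
    induction i with
    | zero => simpa using h0
    | succ i ih =>
      by_cases hm : ((l₁ : ℤ) - (i + 1 : ℕ)) ∈ Finset.Icc (-(l₁ : ℤ)) l₁
      · have h1 := h.raise_top (l₁ - i) (l₃ - l₁ + (i + 1 : ℕ))
        rw [show (l₃ - l₁ + (i + 1 : ℕ) - 1 : ℤ) = l₃ - l₁ + i by push_cast; ring, ih, mul_zero,
          add_zero, show (l₁ - i - 1 : ℤ) = l₁ - (i + 1 : ℕ) by push_cast; ring] at h1
        rw [Finset.mem_Icc] at hm
        have h2 := raiseCoeff_ne_zero hη (l := l₁) (m := l₁ - (i + 1 : ℕ)) hm.1 (by omega)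
        exact (mul_eq_zero.1 h1).resolve_left
          (mul_ne_zero (ofReal_qpow_ne_zero _ _) (Complex.ofReal_ne_zero.2 h2))
      · exact h.range₁ hm _ _
  have top (m₁ m₂ : ℤ) : c m₁ m₂ l₃ = 0 := by
    by_cases hm : m₁ ∈ Finset.Icc (-(l₁ : ℤ)) l₁
    · by_cases hw : (l₃ : ℤ) = m₁ + m₂
      · rw [Finset.mem_Icc] at hm
        have := step (l₁ - m₁).toNat
        rw [Int.toNat_of_nonneg (by omega)] at this
        rwa [show (l₁ : ℤ) - (l₁ - m₁) = m₁ by ring,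
          show (l₃ : ℤ) - l₁ + (l₁ - m₁) = m₂ by omega] at this
      · exact h.weight hw
    · exact h.range₁ hm _ _
  have down (k : ℕ) : ∀ m₁ m₂, c m₁ m₂ (l₃ - k) = 0 := by
    induction k with
    | zero => simpa using top
    | succ k ih =>
      intro m₁ m₂
      by_cases hm : ((l₃ : ℤ) - (k + 1 : ℕ)) ∈ Finset.Icc (-(l₃ : ℤ)) l₃
      · have h1 := h.lower m₁ m₂ (l₃ - k)
        rw [ih, ih, mul_zero, mul_zero, add_zero,
          show (l₃ - k - 1 : ℤ) = l₃ - (k + 1 : ℕ) by push_cast; ring] at h1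
        rw [Finset.mem_Icc] at hm
        have h2 := lowerCoeff_ne_zero hη (l := l₃) (m := l₃ - k) (by omega) (by omega)
        exact (mul_eq_zero.1 h1).resolve_left (Complex.ofReal_ne_zero.2 h2)
      · exact h.range₃ hm _ _
  by_cases hm : m₃ ∈ Finset.Icc (-(l₃ : ℤ)) l₃
  · rw [Finset.mem_Icc] at hm
    have := down (l₃ - m₃).toNat m₁ m₂
    rw [Int.toNat_of_nonneg (by omega)] at this
    rwa [show (l₃ : ℤ) - (l₃ - m₃) = m₃ by ring] at this
  · exact h.range₃ hm _ _

end IsHomArray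

/-! ### Positivity of the square of the highest weight vector -/

theorem qnum_natCast (η : ℝ) (n : ℕ) :
    qnum η n = qpow η (-n / 2) * (1 - (-qpar η) ^ n) / (qpow η (-1 / 2) + qpow η (1 / 2)) := by
  have h1 : qpow η (n / 2) = qpow η (-n / 2) * qpar η ^ n := by
    rw [show qpar η ^ n = qpow η n from (Real.rpow_natCast _ _).symm, qpow_mul]
    ring_nf
  rw [qnum, Int.cast_natCast, h1, neg_pow (qpar η), zpow_natCast]
  ring

/-- The ratio of the squares of consecutive coefficients of the highest weight vector of a real
array, where `N = l₁ + l₂ - l₃` and `B = l₂ + l₃ - l₁`, as a ratio of factors `1 - (-q)^k`. -/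
theorem IsHomArray.sq_rec {η : ℝ} (hη : η ≠ 0) {l₁ l₂ l₃ : ℕ} {p₁ : ZMod 2} {r : ℤ → ℤ → ℤ → ℝ}
    (h : IsHomArray η l₁ p₁ l₂ l₃ fun m₁ m₂ m₃ => (r m₁ m₂ m₃ : ℂ)) {N B : ℕ}
    (hN : N + l₃ = l₁ + l₂) (hB : B + l₁ = l₂ + l₃) {i : ℕ} (hi : i ≤ 2 * l₁) (hiN : i < N) :
    r (l₁ - (i + 1 : ℕ)) (l₃ - l₁ + (i + 1 : ℕ)) l₃ ^ 2 * qpar η ^ (B + 1) *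
        ((1 - (-qpar η) ^ (i + 1)) * (1 - (-qpar η) ^ (2 * l₁ - i)))
      = (1 - (-qpar η) ^ (N - i)) * (1 - (-qpar η) ^ (B + 1 + i)) *
        r (l₁ - i) (l₃ - l₁ + i) l₃ ^ 2 := by
  have h1 := h.raise_top (l₁ - i) (l₃ - l₁ + (i + 1 : ℕ))
  rw [show (l₃ - l₁ + (i + 1 : ℕ) - 1 : ℤ) = l₃ - l₁ + i by push_cast; ring,
    show (l₁ - i - 1 : ℤ) = l₁ - (i + 1 : ℕ) by push_cast; ring] at h1
  set x := r (l₁ - (i + 1 : ℕ)) (l₃ - l₁ + (i + 1 : ℕ)) l₃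
  set y := r (l₁ - i) (l₃ - l₁ + i) l₃
  have h2 : (qpow η ((l₃ - l₁ + (i + 1 : ℕ) : ℤ) / 2) * raiseCoeff η l₁ (l₁ - (i + 1 : ℕ)) * x) ^ 2
      = (qpow η (-(l₁ - i : ℤ) / 2) * raiseCoeff η l₂ (l₃ - l₁ + i) * y) ^ 2 := by
    have hs := sgn_mul_self ((l₁ : ZMod 2) - ((l₁ - i : ℤ) : ZMod 2) + p₁)
    set s := sgn ((l₁ : ZMod 2) - ((l₁ - i : ℤ) : ZMod 2) + p₁)
    apply Complex.ofReal_injective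
    push_cast at h1 ⊢
    rw [eq_neg_of_add_eq_zero_left h1]
    linear_combination ((qpow η (-(l₁ - i) / 2) : ℂ) * raiseCoeff η l₂ (l₃ - l₁ + i) * y) ^ 2 * hs
  have hsq (l : ℕ) (m : ℤ) : raiseCoeff η l m ^ 2 = lowerCoeff η l (m + 1) ^ 2 := by
    rw [raiseCoeff_eq, mul_pow, ← zpow_natCast, ← zpow_mul, mul_comm _ ((2 : ℕ) : ℤ), zpow_mul]
    simp
  have a1 : raiseCoeff η l₁ (l₁ - (i + 1 : ℕ)) ^ 2
      = qnum η (2 * l₁ - i : ℕ) * qnum η (i + 1 : ℕ) * gam η := by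
    rw [hsq, lowerCoeff_sq η (by omega) (by omega)]
    congr 3
    · omega
    · omega
  have a2 : raiseCoeff η l₂ (l₃ - l₁ + i) ^ 2
      = qnum η (B + 1 + i : ℕ) * qnum η (N - i : ℕ) * gam η := by
    rw [hsq, lowerCoeff_sq η (by omega) (by omega)]
    congr 3
    · omega
    · omega
  rw [mul_pow, mul_pow, mul_pow, mul_pow, a1, a2] at h2
  simp only [qnum_natCast] at h2
  have hD := (qnum_den_pos η).ne'
  have e1 : qpow η ((l₃ - l₁ + (i + 1 : ℕ) : ℤ) / 2) ^ 2 * (qpow η (-(2 * l₁ - i : ℕ) / 2)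
      * qpow η (-(i + 1 : ℕ) / 2)) = qpow η (-(l₁ - i : ℤ) / 2) ^ 2 * (qpow η (-(B + 1 + i : ℕ) / 2)
      * qpow η (-(N - i : ℕ) / 2)) * qpar η ^ (B + 1) := by
    rw [show qpar η ^ (B + 1) = qpow η (B + 1 : ℕ) from (Real.rpow_natCast _ _).symm]
    simp only [pow_two, qpow_mul]
    congr 1
    have hN' : (N : ℝ) = l₁ + l₂ - l₃ := by rw [eq_sub_iff_add_eq]; exact_mod_cast hN
    have hB' : (B : ℝ) = l₂ + l₃ - l₁ := by rw [eq_sub_iff_add_eq]; exact_mod_cast hB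
    rw [Nat.cast_sub hi, Nat.cast_sub hiN.le]
    push_cast
    rw [hN', hB']
    ring
  set D := qpow η (-1 / 2) + qpow η (1 / 2)
  have e0 : qpow η (-(l₁ - i : ℤ) / 2) ^ 2 * (qpow η (-(B + 1 + i : ℕ) / 2)
      * qpow η (-(N - i : ℕ) / 2)) * gam η ≠ 0 :=
    mul_ne_zero (mul_ne_zero (pow_ne_zero _ (qpow_pos _ _).ne')
      (mul_ne_zero (qpow_pos _ _).ne' (qpow_pos _ _).ne')) (gam_ne_zero hη)
  apply mul_left_cancel₀ e0
  field_simp at h2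
  simp only [neg_div] at e1 ⊢
  linear_combination h2 - gam η * x ^ 2 * (1 - (-qpar η) ^ (i + 1)) *
    (1 - (-qpar η) ^ (2 * l₁ - i)) * e1

theorem qpar_ne_one {η : ℝ} (hη : η ≠ 0) : qpar η ≠ 1 := by
  rw [qpar, Ne, Real.exp_eq_one_iff]
  intro h
  exact hη (by linarith)

open Finset in
/-- Since `c(m₁, m₂, l₃)` vanishes off the line `m₁ + m₂ = l₃`, the square of the highest weight
vector is a single sum. -/
theorem IsHomArray.sum_sq_eq {η : ℝ} {l₁ l₂ l₃ : ℕ} {p₁ : ZMod 2} {r : ℤ → ℤ → ℤ → ℝ}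
    (h : IsHomArray η l₁ p₁ l₂ l₃ fun m₁ m₂ m₃ => (r m₁ m₂ m₃ : ℂ)) :
    ∑ m₁ : Wt l₁, ∑ m₂ : Wt l₂, (-1 : ℝ) ^ (((l₁ : ℤ) - m₁) * ((l₂ : ℤ) - m₂)) * r m₁ m₂ l₃ ^ 2
      = ∑ i ∈ range (2 * l₁ + 1), (-1 : ℝ) ^ ((i : ℤ) * ((l₁ : ℤ) + l₂ - l₃ - i)) *
          r (l₁ - i) (l₃ - l₁ + i) l₃ ^ 2 := by
  have inner (m₁ : ℤ) :
      ∑ m₂ : Wt l₂, (-1 : ℝ) ^ (((l₁ : ℤ) - m₁) * ((l₂ : ℤ) - m₂)) * r m₁ m₂ l₃ ^ 2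
        = (-1 : ℝ) ^ (((l₁ : ℤ) - m₁) * ((l₂ : ℤ) - (l₃ - m₁))) * r m₁ (l₃ - m₁) l₃ ^ 2 := by
    by_cases hm : (l₃ : ℤ) - m₁ ∈ Icc (-(l₂ : ℤ)) l₂
    · rw [sum_eq_single (⟨l₃ - m₁, hm⟩ : Wt l₂)]
      · intro m₂ _ hne
        have : r m₁ m₂ l₃ = 0 := by
          refine Complex.ofReal_eq_zero.1 (h.weight fun hw => hne (Subtype.ext ?_))
          simp [hw]
        simp [this]
      · simp
    · have hz : r m₁ (l₃ - m₁) l₃ = 0 := Complex.ofReal_eq_zero.1 (h.range₂ hm _ _)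
      rw [hz, zero_pow two_ne_zero, mul_zero]
      refine sum_eq_zero fun m₂ _ => ?_
      have : r m₁ m₂ l₃ = 0 := by
        refine Complex.ofReal_eq_zero.1 (h.weight fun hw => hm ?_)
        rw [hw, add_sub_cancel_left]
        exact m₂.2
      simp [this]
  simp only [inner]
  rw [sum_coe_sort (Icc (-(l₁ : ℤ)) l₁) fun m₁ : ℤ =>
    (-1 : ℝ) ^ (((l₁ : ℤ) - m₁) * ((l₂ : ℤ) - (l₃ - m₁))) * r m₁ (l₃ - m₁) l₃ ^ 2]
  refine (sum_nbij' (fun i : ℕ => (l₁ : ℤ) - i) (fun m => ((l₁ : ℤ) - m).toNat) ?_ ?_ ?_ ?_ ?_).symm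
  · intro i hi
    have := mem_range.1 hi
    exact mem_Icc.2 ⟨by omega, by omega⟩
  · intro m hm
    have := mem_Icc.1 hm
    exact mem_range.2 (by omega)
  · intro i _
    simp
  · intro m hm
    have := mem_Icc.1 hm
    rw [Int.toNat_of_nonneg (by omega)]
    ring
  · intro i _
    rw [show (l₁ : ℤ) - (l₁ - i) = i by ring, show (l₃ : ℤ) - (l₁ - i) = l₃ - l₁ + i by ring,
      show (l₂ : ℤ) - (l₃ - l₁ + i) = l₁ + l₂ - l₃ - i by ring]

open Finset in
/-- The pseudo-orthogonal form is positive on highest weight vectors.  For odd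
`N = l₁ + l₂ - l₃` all signs are positive on the line `m₁ + m₂ = l₃`; for even `N` they alternate,
and the sum is of Chu-Vandermonde type. -/
theorem IsHomArray.sum_sq_pos {η : ℝ} (hη : η ≠ 0) {l₁ l₂ l₃ : ℕ} {p₁ : ZMod 2}
    {r : ℤ → ℤ → ℤ → ℝ} (h : IsHomArray η l₁ p₁ l₂ l₃ fun m₁ m₂ m₃ => (r m₁ m₂ m₃ : ℂ))
    (h0 : r l₁ (l₃ - l₁) l₃ ≠ 0) :
    0 < ∑ m₁ : Wt l₁, ∑ m₂ : Wt l₂,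
      (-1 : ℝ) ^ (((l₁ : ℤ) - m₁) * ((l₂ : ℤ) - m₂)) * r m₁ m₂ l₃ ^ 2 := by
  have hrange : (l₃ : ℤ) - l₁ ∈ Icc (-(l₂ : ℤ)) l₂ := by
    by_contra hm
    exact h0 (Complex.ofReal_eq_zero.1 (h.range₂ hm _ _))
  rw [mem_Icc] at hrange
  obtain ⟨N, hN⟩ : ∃ N : ℕ, N + l₃ = l₁ + l₂ := ⟨l₁ + l₂ - l₃, by omega⟩
  obtain ⟨B, hB⟩ : ∃ B : ℕ, B + l₁ = l₂ + l₃ := ⟨l₂ + l₃ - l₁, by omega⟩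
  obtain ⟨f, hf⟩ : ∃ f : ℕ → ℝ, ∀ i : ℕ, r (l₁ - i) (l₃ - l₁ + i) l₃ = f i := ⟨_, fun _ => rfl⟩
  have hf0 : f 0 ≠ 0 := by rw [← hf]; simpa using h0
  have hNZ : (l₁ : ℤ) + l₂ - l₃ = N := by omega
  rw [h.sum_sq_eq]
  simp only [hf, hNZ]
  rcases Nat.even_or_odd N with he | ho
  · have hrec (i : ℕ) (hi : i ≤ 2 * l₁) (hiN : i < N) := h.sq_rec hη hN hB hi hiN
    simp only [hf] at hrec
    have hne (k : ℕ) : 1 - (-qpar η) ^ (k + 1) ≠ 0 := fun h0 => by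
      have hq0 : -qpar η < 0 := neg_neg_of_pos (Real.exp_pos _)
      have := one_sub_pow_mul_pos hq0 (fun h => qpar_ne_one hη (neg_injective h))
        (Nat.succ_pos k) (Nat.succ_pos k) ⟨_, rfl⟩
      simp [h0] at this
    have hNM : N ≤ 2 * l₁ := by
      by_contra! hlt
      -- Otherwise the coefficients stay nonzero down to `m₁ = -l₁ - 1`.
      have hnz (i : ℕ) (hi : i ≤ 2 * l₁ + 1) : f i ≠ 0 := by
        induction i with
        | zero => exact hf0
        | succ i ih =>
          intro hz
          have h1 := hrec i (by omega) (by omega)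
          obtain ⟨k, hk⟩ : ∃ k, N - i = k + 1 := ⟨N - i - 1, by omega⟩
          rw [hz, hk, show B + 1 + i = B + i + 1 by ring] at h1
          simp only [ne_eq, OfNat.ofNat_ne_zero, not_false_eq_true, zero_pow, zero_mul] at h1
          exact mul_ne_zero (mul_ne_zero (hne _) (hne _)) (pow_ne_zero 2 (ih (by omega))) h1.symm
      refine hnz (2 * l₁ + 1) le_rfl ?_
      rw [← hf]
      refine Complex.ofReal_eq_zero.1 (h.range₁ ?_ _ _)
      rw [mem_Icc]
      push_cast
      omega
    have hpos := alternating_sum_pos (q := qpar η) (Real.exp_pos _) (qpar_ne_one hη) he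
      (M := 2 * l₁) (even_two_mul _) (B := B)
      (by obtain ⟨n, hn⟩ := he; exact ⟨l₂ - n, by omega⟩) hNM
      (w := fun i => f i ^ 2) (by positivity) (fun i hi => hrec i (by omega) hi)
    refine lt_of_lt_of_eq hpos ?_
    refine (sum_congr rfl fun i _ => ?_).trans
      (sum_subset (range_subset_range.2 (by omega)) fun i _ hi => ?_)
    · congr 1
      obtain ⟨n, hn⟩ := he
      rcases Nat.even_or_odd i with hi | hi
      · have hi' : Even (i : ℤ) := by exact_mod_cast hi
        rw [hi.neg_one_pow, (hi'.mul_right _).neg_one_zpow]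
      · have hi' : Odd (i : ℤ) := by exact_mod_cast hi
        have : Odd ((i : ℤ) * (N - i)) :=
          hi'.mul (Even.sub_odd ⟨n, by exact_mod_cast hn⟩ hi')
        rw [hi.neg_one_pow, this.neg_one_zpow]
    · have hz : f i = 0 := by
        rw [← hf]
        refine Complex.ofReal_eq_zero.1 (h.range₂ ?_ _ _)
        rw [mem_range] at hi
        rw [mem_Icc]
        omega
      rw [hz]; simp
  · have hsign (i : ℕ) : (-1 : ℝ) ^ ((i : ℤ) * (N - i)) = 1 := by
      apply Even.neg_one_zpow
      have ho' : Odd (N : ℤ) := by exact_mod_cast ho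
      rcases Int.even_or_odd (i : ℤ) with hi | hi
      · exact hi.mul_right _
      · exact (ho'.sub_odd hi).mul_left _
    simp only [hsign, one_mul]
    exact sum_pos' (fun i _ => sq_nonneg _) ⟨0, by simp, by positivity⟩

/-! ### Homomorphisms `V^{l₃} → V^{l₁} ⊗ V^{l₂}` and their arrays -/

section TensorAction

variable {η : ℝ} {V W : Type*} [AddCommGroup V] [Module ℂ V] [AddCommGroup W] [Module ℂ W]
  (ρ : GradedRep η V) (σ : GradedRep η W)

theorem tensor_act_H (v : V) (w : W) : (ρ.tensor σ).act (ug η .H) (v ⊗ₜ[ℂ] w)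
    = ρ.act (ug η .H) v ⊗ₜ[ℂ] w + v ⊗ₜ[ℂ] σ.act (ug η .H) w := by
  have m1 : (1 : Uq η) ∈ grading η 0 := SetLike.GradedOne.one_mem
  have mH : ug η .H ∈ grading η 0 := ug_mem η .H
  simp [GradedRep.tensor, tensorAct, coproduct, coprodGen, pure₂, tensorRight_apply,
    tensorLeft_tmul, tensorRightLin_of_mem ρ σ m1, tensorRightLin_of_mem ρ σ mH, ipow]

theorem tensor_act_K (v : V) (w : W) : (ρ.tensor σ).act (ug η .K) (v ⊗ₜ[ℂ] w)
    = ρ.act (ug η .K) v ⊗ₜ[ℂ] σ.act (ug η .K) w := by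
  have mK : ug η .K ∈ grading η 0 := ug_mem η .K
  simp [GradedRep.tensor, tensorAct, coproduct, coprodGen, pure₂, tensorRight_apply,
    tensorLeft_tmul, tensorRightLin_of_mem ρ σ mK, ipow]

theorem tensor_act_Kinv (v : V) (w : W) : (ρ.tensor σ).act (ug η .Kinv) (v ⊗ₜ[ℂ] w)
    = ρ.act (ug η .Kinv) v ⊗ₜ[ℂ] σ.act (ug η .Kinv) w := by
  have mK : ug η .Kinv ∈ grading η 0 := ug_mem η .Kinv
  simp [GradedRep.tensor, tensorAct, coproduct, coprodGen, pure₂, tensorRight_apply,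
    tensorLeft_tmul, tensorRightLin_of_mem ρ σ mK, ipow]

theorem tensor_act_vm (v : V) (w : W) : (ρ.tensor σ).act (ug η .vm) (v ⊗ₜ[ℂ] w)
    = ρ.act (ug η .vm) v ⊗ₜ[ℂ] σ.act (ug η .K) w
      + ρ.act (ug η .Kinv) (ρ.par v) ⊗ₜ[ℂ] σ.act (ug η .vm) w := by
  have mK : ug η .K ∈ grading η 0 := ug_mem η .K
  have mv : ug η .vm ∈ grading η 1 := ug_mem η .vm
  simp [GradedRep.tensor, tensorAct, coproduct, coprodGen, pure₂, tensorRight_apply,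
    tensorLeft_tmul, tensorRightLin_of_mem ρ σ mK, tensorRightLin_of_mem ρ σ mv, ipow]

theorem tensor_act_vp (v : V) (w : W) : (ρ.tensor σ).act (ug η .vp) (v ⊗ₜ[ℂ] w)
    = ρ.act (ug η .vp) v ⊗ₜ[ℂ] σ.act (ug η .K) w
      + ρ.act (ug η .Kinv) (ρ.par v) ⊗ₜ[ℂ] σ.act (ug η .vp) w := by
  have mK : ug η .K ∈ grading η 0 := ug_mem η .K
  have mv : ug η .vp ∈ grading η 1 := ug_mem η .vp
  simp [GradedRep.tensor, tensorAct, coproduct, coprodGen, pure₂, tensorRight_apply,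
    tensorLeft_tmul, tensorRightLin_of_mem ρ σ mK, tensorRightLin_of_mem ρ σ mv, ipow]

end TensorAction

section TensorCoordinates

variable {η : ℝ} {l₁ l₂ : ℕ} (p₁ p₂ : ZMod 2) (m₁ m₂ : ℤ) (z : Vsp l₁ ⊗[ℂ] Vsp l₂)

theorem tcoord_act_H :
    tcoord l₁ l₂ m₁ m₂ (((irrep η l₁ p₁).tensor (irrep η l₂ p₂)).act (ug η .H) z)
      = ((m₁ + m₂ : ℤ) / 2 : ℂ) * tcoord l₁ l₂ m₁ m₂ z := by
  induction z using TensorProduct.induction_on with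
  | zero => simp
  | tmul v w =>
    rw [tensor_act_H, map_add]
    simp only [tcoord_tmul, coord_act_H]
    push_cast
    ring
  | add x y hx hy => simp only [map_add, hx, hy, mul_add]

theorem tcoord_act_K :
    tcoord l₁ l₂ m₁ m₂ (((irrep η l₁ p₁).tensor (irrep η l₂ p₂)).act (ug η .K) z)
      = (qpow η ((m₁ + m₂ : ℤ) / 2) : ℂ) * tcoord l₁ l₂ m₁ m₂ z := by
  induction z using TensorProduct.induction_on with
  | zero => simp
  | tmul v w =>
    rw [tensor_act_K]
    simp only [tcoord_tmul, coord_act_K]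
    rw [show ((m₁ + m₂ : ℤ) / 2 : ℝ) = m₁ / 2 + m₂ / 2 by push_cast; ring, ← qpow_mul]
    push_cast
    ring
  | add x y hx hy => simp only [map_add, hx, hy, mul_add]

theorem tcoord_act_Kinv :
    tcoord l₁ l₂ m₁ m₂ (((irrep η l₁ p₁).tensor (irrep η l₂ p₂)).act (ug η .Kinv) z)
      = (qpow η (-(m₁ + m₂ : ℤ) / 2) : ℂ) * tcoord l₁ l₂ m₁ m₂ z := by
  induction z using TensorProduct.induction_on with
  | zero => simp
  | tmul v w =>
    rw [tensor_act_Kinv]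
    simp only [tcoord_tmul, coord_act_Kinv]
    rw [show (-(m₁ + m₂ : ℤ) / 2 : ℝ) = -m₁ / 2 + -m₂ / 2 by push_cast; ring, ← qpow_mul]
    push_cast
    ring
  | add x y hx hy => simp only [map_add, hx, hy, mul_add]

theorem tcoord_act_vm :
    tcoord l₁ l₂ m₁ m₂ (((irrep η l₁ p₁).tensor (irrep η l₂ p₂)).act (ug η .vm) z)
      = (qpow η (m₂ / 2) : ℂ) * lowerCoeff η l₁ (m₁ + 1) * tcoord l₁ l₂ (m₁ + 1) m₂ z
        + sgn ((l₁ : ZMod 2) - (m₁ : ZMod 2) + p₁) * (qpow η (-m₁ / 2) : ℂ)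
          * lowerCoeff η l₂ (m₂ + 1) * tcoord l₁ l₂ m₁ (m₂ + 1) z := by
  induction z using TensorProduct.induction_on with
  | zero => simp
  | tmul v w =>
    rw [tensor_act_vm, map_add]
    simp only [tcoord_tmul, coord_act_Kinv, coord_act_K, coord_act_vm, coord_par]
    ring
  | add x y hx hy => simp only [map_add, hx, hy]; ring

theorem tcoord_act_vp :
    tcoord l₁ l₂ m₁ m₂ (((irrep η l₁ p₁).tensor (irrep η l₂ p₂)).act (ug η .vp) z)
      = (qpow η (m₂ / 2) : ℂ) * raiseCoeff η l₁ (m₁ - 1) * tcoord l₁ l₂ (m₁ - 1) m₂ z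
        + sgn ((l₁ : ZMod 2) - (m₁ : ZMod 2) + p₁) * (qpow η (-m₁ / 2) : ℂ)
          * raiseCoeff η l₂ (m₂ - 1) * tcoord l₁ l₂ m₁ (m₂ - 1) z := by
  induction z using TensorProduct.induction_on with
  | zero => simp
  | tmul v w =>
    rw [tensor_act_vp, map_add]
    simp only [tcoord_tmul, coord_act_Kinv, coord_act_K, coord_act_vp, coord_par]
    ring
  | add x y hx hy => simp only [map_add, hx, hy]; ring

theorem tcoord_par :
    tcoord l₁ l₂ m₁ m₂ (((irrep η l₁ p₁).tensor (irrep η l₂ p₂)).par z)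
      = sgn ((l₁ : ZMod 2) - (m₁ : ZMod 2) + p₁) * sgn ((l₂ : ZMod 2) - (m₂ : ZMod 2) + p₂)
        * tcoord l₁ l₂ m₁ m₂ z := by
  induction z using TensorProduct.induction_on with
  | zero => simp
  | tmul v w =>
    simp only [GradedRep.tensor, tensorPar, TensorProduct.map_tmul, tcoord_tmul, coord_par]
    ring
  | add x y hx hy => simp only [map_add, hx, hy, mul_add]

theorem tcoord_of_notMem_left {m₁ : ℤ} (h : m₁ ∉ Finset.Icc (-(l₁ : ℤ)) l₁) (m₂ : ℤ) :
    tcoord l₁ l₂ m₁ m₂ z = 0 := by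
  induction z using TensorProduct.induction_on with
  | zero => simp
  | tmul v w => simp [coord_of_notMem h]
  | add x y hx hy => simp only [map_add, hx, hy, add_zero]

theorem tcoord_of_notMem_right {m₂ : ℤ} (h : m₂ ∉ Finset.Icc (-(l₂ : ℤ)) l₂) (m₁ : ℤ) :
    tcoord l₁ l₂ m₁ m₂ z = 0 := by
  induction z using TensorProduct.induction_on with
  | zero => simp
  | tmul v w => simp [coord_of_notMem h]
  | add x y hx hy => simp only [map_add, hx, hy, add_zero]

end TensorCoordinates

/-- An even intertwiner commutes with the action of every generator. -/
theorem intertwiners_even_apply {η : ℝ} {V W : Type*} [AddCommGroup V] [Module ℂ V]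
    [AddCommGroup W] [Module ℂ W] {ρ : GradedRep η V} {σ : GradedRep η W} {f : V →ₗ[ℂ] W}
    (hf : f ∈ intertwiners ρ σ 0) (g : Gen) (v : V) :
    f (ρ.act (ug η g) v) = σ.act (ug η g) (f v) := by
  have := DFunLike.congr_fun (hf.2 g.deg _ (ug_mem η g)) v
  simpa using this

/-- It suffices to test the even intertwiner property on the parities and the generators. -/
theorem mem_intertwiners_even {η : ℝ} {V W : Type*} [AddCommGroup V] [Module ℂ V]
    [AddCommGroup W] [Module ℂ W] {ρ : GradedRep η V} {σ : GradedRep η W} {f : V →ₗ[ℂ] W}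
    (hpar : ∀ v, f (ρ.par v) = σ.par (f v))
    (hgen : ∀ g v, f (ρ.act (ug η g) v) = σ.act (ug η g) (f v)) :
    f ∈ intertwiners ρ σ 0 := by
  have hact (a : Uq η) : ∀ v, f (ρ.act a v) = σ.act a (f v) := by
    obtain ⟨x, rfl⟩ := RingQuot.mkAlgHom_surjective ℂ (Rel η) a
    change ∀ v, f (ρ.act (mkUq η x) v) = σ.act (mkUq η x) (f v)
    induction x using FreeAlgebra.induction with
    | grade0 r =>
      intro v
      rw [AlgHom.commutes, AlgHom.commutes, AlgHom.commutes, Module.algebraMap_end_apply,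
        Module.algebraMap_end_apply, map_smul]
    | grade1 g => exact hgen g
    | mul a b ha hb => intro v; simp [ha, hb]
    | add a b ha hb => intro v; simp [ha, hb]
  refine ⟨fun i v hv => ?_, fun i a _ => ?_⟩
  · rw [GradedRep.homog, Module.End.mem_eigenspace_iff] at hv ⊢
    rw [← hpar, hv, map_smul, add_zero]
  · ext v
    simp [hact]

section HomArrays

variable {η : ℝ} {l₁ l₂ l₃ : ℕ} {p₁ p₂ p₃ : ZMod 2}

theorem isHomArray_of_mem_intertwiners {f : Vsp l₃ →ₗ[ℂ] Vsp l₁ ⊗[ℂ] Vsp l₂}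
    (hf : f ∈ intertwiners (irrep η l₃ p₃) ((irrep η l₁ p₁).tensor (irrep η l₂ p₂)) 0) :
    IsHomArray η l₁ p₁ l₂ l₃ fun m₁ m₂ m₃ => tcoord l₁ l₂ m₁ m₂ (f (bvZ l₃ m₃)) where
  range₁ hm m₂ m₃ := tcoord_of_notMem_left _ hm _
  range₂ hm m₂ m₃ := tcoord_of_notMem_right _ hm _
  range₃ hm m₁ m₂ := by rw [bvZ_of_notMem hm, map_zero, map_zero]
  weight {m₁ m₂ m₃} hm := by
    have h := congrArg (tcoord l₁ l₂ m₁ m₂) (intertwiners_even_apply hf .H (bvZ l₃ m₃))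
    rw [tcoord_act_H, act_H_bvZ, map_smul, map_smul, smul_eq_mul] at h
    have h' : ((m₃ : ℂ) - (m₁ + m₂ : ℤ)) * tcoord l₁ l₂ m₁ m₂ (f (bvZ l₃ m₃)) = 0 := by
      linear_combination 2 * h
    refine (mul_eq_zero.1 h').resolve_left ?_
    rw [sub_eq_zero]
    exact_mod_cast hm
  lower m₁ m₂ m₃ := by
    rw [← tcoord_act_vm p₁ p₂, ← intertwiners_even_apply hf, act_vm_bvZ, map_smul, map_smul,
      smul_eq_mul]
  raise m₁ m₂ m₃ := by
    rw [← tcoord_act_vp p₁ p₂, ← intertwiners_even_apply hf, act_vp_bvZ, map_smul, map_smul,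
      smul_eq_mul]

theorem tcoord_reducedVec (c : Wt l₁ → Wt l₂ → Wt l₃ → ℝ) (m₁ : Wt l₁) (m₂ : Wt l₂) (m : Wt l₃) :
    tcoord l₁ l₂ m₁ m₂ (reducedVec c m) = c m₁ m₂ m := by
  simp only [reducedVec, map_sum, map_smul, tcoord_tmul, coord_coe, smul_eq_mul]
  rw [Finset.sum_eq_single m₁, Finset.sum_eq_single m₂]
  · simp [bv]
  · intro b _ hb
    simp [bv, hb.symm]
  · simp
  · intro b _ hb
    simp [bv, hb.symm]
  · simp

theorem linearCombination_bv (x : Wt l₃ → Vsp l₁ ⊗[ℂ] Vsp l₂) (m : Wt l₃) :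
    Fintype.linearCombination ℂ x (bv m) = x m := by
  simp [bv, Fintype.linearCombination_apply_single]

theorem linearCombination_mem_intertwiners (hp : p₃ = p₁ + p₂ + (l₁ + l₂ + l₃ : ℕ))
    {r : ℤ → ℤ → ℤ → ℝ} (h : IsHomArray η l₁ p₁ l₂ l₃ fun m₁ m₂ m₃ => (r m₁ m₂ m₃ : ℂ)) :
    Fintype.linearCombination ℂ
        (reducedVec fun (m₁ : Wt l₁) (m₂ : Wt l₂) (m₃ : Wt l₃) => r m₁ m₂ m₃)
      ∈ intertwiners (irrep η l₃ p₃) ((irrep η l₁ p₁).tensor (irrep η l₂ p₂)) 0 := by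
  set f := Fintype.linearCombination ℂ
    (reducedVec fun (m₁ : Wt l₁) (m₂ : Wt l₂) (m₃ : Wt l₃) => r m₁ m₂ m₃) with hf
  have hfr (m₁ m₂ m₃ : ℤ) : tcoord l₁ l₂ m₁ m₂ (f (bvZ l₃ m₃)) = r m₁ m₂ m₃ := by
    by_cases h1 : m₁ ∈ Finset.Icc (-(l₁ : ℤ)) l₁
    · by_cases h2 : m₂ ∈ Finset.Icc (-(l₂ : ℤ)) l₂
      · by_cases h3 : m₃ ∈ Finset.Icc (-(l₃ : ℤ)) l₃
        · have := tcoord_reducedVec (fun (m₁ : Wt l₁) (m₂ : Wt l₂) (m₃ : Wt l₃) => r m₁ m₂ m₃)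
            ⟨m₁, h1⟩ ⟨m₂, h2⟩ ⟨m₃, h3⟩
          rwa [← linearCombination_bv (reducedVec _), ← bvZ_coe] at this
        · rw [h.range₃ h3, bvZ_of_notMem h3, map_zero, map_zero]
      · rw [h.range₂ h2, tcoord_of_notMem_right _ h2]
    · rw [h.range₁ h1, tcoord_of_notMem_left _ h1]
  have ext {A : Module.End ℂ (Vsp l₃)} {A' : Module.End ℂ (Vsp l₁ ⊗[ℂ] Vsp l₂)}
      (hA : ∀ m₁ m₂ m₃ : ℤ, tcoord l₁ l₂ m₁ m₂ (f (A (bvZ l₃ m₃)))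
        = tcoord l₁ l₂ m₁ m₂ (A' (f (bvZ l₃ m₃)))) (v : Vsp l₃) : f (A v) = A' (f v) := by
    have : f ∘ₗ A = A' ∘ₗ f := by
      apply (Pi.basisFun ℂ (Wt l₃)).ext
      intro m
      rw [Pi.basisFun_apply]
      apply tcoord_ext
      intro m₁ m₂
      have := hA m₁ m₂ m
      rwa [bvZ_coe] at this
    exact DFunLike.congr_fun this v
  have diag {F : ℤ → ℂ} (m₁ m₂ m₃ : ℤ) : F m₃ * (r m₁ m₂ m₃ : ℂ) = F (m₁ + m₂) * r m₁ m₂ m₃ := by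
    by_cases hm : m₃ = m₁ + m₂
    · rw [hm]
    · rw [h.weight hm, mul_zero, mul_zero]
  apply mem_intertwiners_even
  · apply ext
    intro m₁ m₂ m₃
    rw [tcoord_par, par_bvZ, map_smul, map_smul, hfr, smul_eq_mul]
    rw [diag (F := fun m => sgn ((l₃ : ZMod 2) - (m : ZMod 2) + p₃)), ← sgn_add, hp]
    congr 2
    have h2 (x : ZMod 2) : x + x = 0 := by revert x; decide
    push_cast
    linear_combination h2 (l₃ : ZMod 2)
  · intro g
    apply ext
    intro m₁ m₂ m₃
    cases g
    · rw [tcoord_act_H, act_H_bvZ, map_smul, map_smul, hfr, smul_eq_mul]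
      exact diag (F := fun m => (m / 2 : ℂ)) m₁ m₂ m₃
    · rw [tcoord_act_vp, act_vp_bvZ, map_smul, map_smul, hfr, hfr, hfr, smul_eq_mul, h.raise]
    · rw [tcoord_act_vm, act_vm_bvZ, map_smul, map_smul, hfr, hfr, hfr, smul_eq_mul, h.lower]
    · rw [tcoord_act_K, act_K_bvZ, map_smul, map_smul, hfr, smul_eq_mul]
      exact diag (F := fun m => (qpow η (m / 2) : ℂ)) m₁ m₂ m₃
    · rw [tcoord_act_Kinv, act_Kinv_bvZ, map_smul, map_smul, hfr, smul_eq_mul]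
      exact diag (F := fun m => (qpow η (-m / 2) : ℂ)) m₁ m₂ m₃

end HomArrays

/-! ### Tensor operators and their arrays -/

section HomAction

variable {η : ℝ} {V W : Type*} [AddCommGroup V] [Module ℂ V] [AddCommGroup W] [Module ℂ W]
  (ρ : GradedRep η V) (σ : GradedRep η W) (φ : V →ₗ[ℂ] W) (v : V)

theorem hom_act_H : (ρ.hom σ).act (ug η .H) φ v
    = σ.act (ug η .H) (φ v) - φ (ρ.act (ug η .H) v) := by
  have m1 : (1 : Uq η) ∈ grading η 0 := SetLike.GradedOne.one_mem
  have mH : ug η .H ∈ grading η 0 := ug_mem η .H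
  simp [-Complex.coe_smul, GradedRep.hom, homAct, coproduct, coprodGen, pure₂, homRight_apply, homLeft,
    homRightLin_of_mem ρ σ m1, homRightLin_of_mem ρ σ mH, ipow, antipode_H, antipode_one,
    sub_eq_add_neg]

theorem hom_act_vp : (ρ.hom σ).act (ug η .vp) φ v
    = σ.act (ug η .vp) (φ (ρ.act (ug η .Kinv) v))
      - (qpow η (1 / 2) : ℂ) • σ.act (ug η .Kinv) (homPar ρ σ φ (ρ.act (ug η .vp) v)) := by
  have mK : ug η .K ∈ grading η 0 := ug_mem η .K
  have mv : ug η .vp ∈ grading η 1 := ug_mem η .vp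
  simp [-Complex.coe_smul, GradedRep.hom, homAct, coproduct, coprodGen, pure₂, homRight_apply, homLeft,
    homRightLin_of_mem ρ σ mK, homRightLin_of_mem ρ σ mv, ipow, antipode_K, antipode_vp,
    sub_eq_add_neg]

theorem hom_act_vm : (ρ.hom σ).act (ug η .vm) φ v
    = σ.act (ug η .vm) (φ (ρ.act (ug η .Kinv) v))
      - (qpow η (-1 / 2) : ℂ) • σ.act (ug η .Kinv) (homPar ρ σ φ (ρ.act (ug η .vm) v)) := by
  have mK : ug η .K ∈ grading η 0 := ug_mem η .K
  have mv : ug η .vm ∈ grading η 1 := ug_mem η .vm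
  simp [-Complex.coe_smul, GradedRep.hom, homAct, coproduct, coprodGen, pure₂, homRight_apply, homLeft,
    homRightLin_of_mem ρ σ mK, homRightLin_of_mem ρ σ mv, ipow, antipode_K, antipode_vm,
    sub_eq_add_neg]

end HomAction

section TensorOperators

variable {η : ℝ} {l₁ l₂ l₃ : ℕ} {p₁ p₂ p₃ d : ZMod 2} {T : Vsp l₁ →ₗ[ℂ] Vsp l₂ →ₗ[ℂ] Vsp l₃}

/-- The matrix elements of `T`, indexed by all integers. -/
def opCoeff (T : Vsp l₁ →ₗ[ℂ] Vsp l₂ →ₗ[ℂ] Vsp l₃) (m₁ m₂ m₃ : ℤ) : ℂ :=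
  coord l₃ m₃ (T (bvZ l₁ m₁) (bvZ l₂ m₂))

theorem opCoeff_coe (m₁ : Wt l₁) (m₂ : Wt l₂) (m₃ : Wt l₃) :
    opCoeff T m₁ m₂ m₃ = LinearMap.toMatrix' (T (bv m₁)) m₃ m₂ := by
  rw [opCoeff, coord_coe, bvZ_coe, bvZ_coe, LinearMap.toMatrix'_apply]
  congr 2

theorem eq_zero_of_opCoeff (h : ∀ m₁ m₂ m₃, opCoeff T m₁ m₂ m₃ = 0) : T = 0 := by
  apply (Pi.basisFun ℂ (Wt l₁)).ext
  intro m₁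
  apply (Pi.basisFun ℂ (Wt l₂)).ext
  intro m₂
  rw [Pi.basisFun_apply, Pi.basisFun_apply]
  apply coord_ext
  intro m₃
  have := h m₁ m₂ m₃
  rw [opCoeff, bvZ_coe, bvZ_coe] at this
  simpa [bv] using this

theorem opCoeff_weight
    (hT : T ∈ intertwiners (irrep η l₁ p₁) ((irrep η l₂ p₂).hom (irrep η l₃ p₃)) d)
    {m₁ m₂ m₃ : ℤ} (hm : m₃ ≠ m₁ + m₂) : opCoeff T m₁ m₂ m₃ = 0 := by
  have h0 := DFunLike.congr_fun (hT.2 0 _ (ug_mem η .H)) (bvZ l₁ m₁)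
  have h := congrArg (coord l₃ m₃) (DFunLike.congr_fun h0 (bvZ l₂ m₂))
  simp only [LinearMap.comp_apply, zero_mul, sgn_zero, one_smul, hom_act_H, act_H_bvZ, map_smul,
    map_sub, coord_act_H, LinearMap.smul_apply, smul_eq_mul] at h
  change _ * opCoeff T m₁ m₂ m₃ = _ * opCoeff T m₁ m₂ m₃ - _ * opCoeff T m₁ m₂ m₃ at h
  have h' : ((m₃ : ℂ) - (m₁ + m₂ : ℤ)) * opCoeff T m₁ m₂ m₃ = 0 := by
    push_cast
    linear_combination -2 * h
  refine (mul_eq_zero.1 h').resolve_left ?_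
  rw [sub_eq_zero]
  exact_mod_cast hm

theorem homPar_bvZ
    (hT : T ∈ intertwiners (irrep η l₁ p₁) ((irrep η l₂ p₂).hom (irrep η l₃ p₃)) d) (m₁ : ℤ) :
    homPar (irrep η l₂ p₂) (irrep η l₃ p₃) (T (bvZ l₁ m₁))
      = sgn ((l₁ : ZMod 2) - (m₁ : ZMod 2) + p₁ + d) • T (bvZ l₁ m₁) :=
  Module.End.mem_eigenspace_iff.1
    (hT.1 _ _ (Module.End.mem_eigenspace_iff.2 (par_bvZ (η := η) p₁ m₁)))

/-- Odd tensor operators vanish: on the matrix elements with `m₃ = m₁ + m₂` the parities leave no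
room for an odd operator. -/
theorem odd_tensorOperator_eq_zero (hp : p₃ = p₁ + p₂ + (l₁ + l₂ + l₃ : ℕ))
    (hT : T ∈ intertwiners (irrep η l₁ p₁) ((irrep η l₂ p₂).hom (irrep η l₃ p₃)) 1) : T = 0 := by
  apply eq_zero_of_opCoeff
  intro m₁ m₂ m₃
  by_cases hm : m₃ = m₁ + m₂
  · have h := congrArg (coord l₃ m₃) (DFunLike.congr_fun (homPar_bvZ hT m₁) (bvZ l₂ m₂))
    simp only [homPar_apply, LinearMap.comp_apply, LinearMap.smul_apply, map_smul, par_bvZ,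
      coord_par, smul_eq_mul] at h
    change _ * (_ * opCoeff T m₁ m₂ m₃) = _ * opCoeff T m₁ m₂ m₃ at h
    rw [← mul_assoc, ← sgn_add] at h
    have h2 (x : ZMod 2) : x + x = 0 := by revert x; decide
    have hs : (l₁ : ZMod 2) - (m₁ : ZMod 2) + p₁ + 1
        = ((l₂ : ZMod 2) - (m₂ : ZMod 2) + p₂ + ((l₃ : ZMod 2) - (m₃ : ZMod 2) + p₃)) + 1 := by
      rw [hp, hm]
      push_cast
      linear_combination h2 (m₂ : ZMod 2) - h2 (l₂ : ZMod 2) - h2 (l₃ : ZMod 2) - h2 p₂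
    rw [hs, sgn_add _ 1, sgn_one] at h
    have hsq := sgn_mul_self
      ((l₂ : ZMod 2) - (m₂ : ZMod 2) + p₂ + ((l₃ : ZMod 2) - (m₃ : ZMod 2) + p₃))
    set s := sgn ((l₂ : ZMod 2) - (m₂ : ZMod 2) + p₂ + ((l₃ : ZMod 2) - (m₃ : ZMod 2) + p₃))
    linear_combination s / 2 * h - opCoeff T m₁ m₂ m₃ * hsq
  · exact opCoeff_weight hT hm

theorem opCoeff_vp
    (hT : T ∈ intertwiners (irrep η l₁ p₁) ((irrep η l₂ p₂).hom (irrep η l₃ p₃)) 0)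
    (m₁ m₂ m₃ : ℤ) : (raiseCoeff η l₁ m₁ : ℂ) * opCoeff T (m₁ + 1) m₂ m₃
      = (qpow η (-m₂ / 2) : ℂ) * raiseCoeff η l₃ (m₃ - 1) * opCoeff T m₁ m₂ (m₃ - 1)
        - sgn ((l₁ : ZMod 2) - (m₁ : ZMod 2) + p₁) * (qpow η (1 / 2) : ℂ) *
          (qpow η (-m₃ / 2) : ℂ) * raiseCoeff η l₂ m₂ * opCoeff T m₁ (m₂ + 1) m₃ := by
  have h0 := intertwiners_even_apply hT .vp (bvZ l₁ m₁)
  have h := congrArg (coord l₃ m₃) (DFunLike.congr_fun h0 (bvZ l₂ m₂))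
  simp only [hom_act_vp, homPar_bvZ hT, act_vp_bvZ, act_Kinv_bvZ, map_smul, map_sub, coord_act_vp,
    coord_act_Kinv, LinearMap.smul_apply, smul_eq_mul, add_zero] at h
  simp only [opCoeff]
  linear_combination h

theorem opCoeff_vm
    (hT : T ∈ intertwiners (irrep η l₁ p₁) ((irrep η l₂ p₂).hom (irrep η l₃ p₃)) 0)
    (m₁ m₂ m₃ : ℤ) : (lowerCoeff η l₁ m₁ : ℂ) * opCoeff T (m₁ - 1) m₂ m₃
      = (qpow η (-m₂ / 2) : ℂ) * lowerCoeff η l₃ (m₃ + 1) * opCoeff T m₁ m₂ (m₃ + 1)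
        - sgn ((l₁ : ZMod 2) - (m₁ : ZMod 2) + p₁) * (qpow η (-1 / 2) : ℂ) *
          (qpow η (-m₃ / 2) : ℂ) * lowerCoeff η l₂ m₂ * opCoeff T m₁ (m₂ - 1) m₃ := by
  have h0 := intertwiners_even_apply hT .vm (bvZ l₁ m₁)
  have h := congrArg (coord l₃ m₃) (DFunLike.congr_fun h0 (bvZ l₂ m₂))
  simp only [hom_act_vm, homPar_bvZ hT, act_vm_bvZ, act_Kinv_bvZ, map_smul, map_sub, coord_act_vm,
    coord_act_Kinv, LinearMap.smul_apply, smul_eq_mul, add_zero] at h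
  simp only [opCoeff]
  linear_combination h

/-- The sign between Clebsch-Gordan coefficients and modified ones. -/
def modSign (l₁ l₂ l₃ : ℕ) (m₁ m₂ m₃ : ℤ) : ℝ :=
  (-1) ^ (((l₁ : ℤ) - m₁) * ((l₂ : ℤ) - m₂)) * (-1) ^ (((l₃ : ℤ) - m₃) * ((l₁ : ℤ) + l₂ + l₃))

theorem neg_one_zpow_congr {a b : ℤ} (h : Even (a - b)) : (-1 : ℝ) ^ a = (-1) ^ b := by
  rw [← sub_add_cancel a b, zpow_add₀ (by norm_num), h.neg_one_zpow, one_mul]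

theorem neg_one_zpow_mul_self (a : ℤ) : (-1 : ℝ) ^ a * (-1) ^ a = 1 := by
  rw [← zpow_add₀ (by norm_num), (Even.neg_one_zpow ⟨a, rfl⟩)]

theorem modSign_mul_self (l₁ l₂ l₃ : ℕ) (m₁ m₂ m₃ : ℤ) :
    modSign l₁ l₂ l₃ m₁ m₂ m₃ * modSign l₁ l₂ l₃ m₁ m₂ m₃ = 1 := by
  rw [modSign, ← zpow_add₀ (by norm_num), neg_one_zpow_mul_self]

/-- Transposition: with the signs `modSign`, the matrix elements of an even tensor operator are the
coefficients of a homomorphism `V^{l₃} → V^{l₁} ⊗ V^{l₂}`.  The condition for `v₊` on the former is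
the one for `v₋` on the latter, and vice versa. -/
theorem isHomArray_opCoeff
    (hT : T ∈ intertwiners (irrep η l₁ p₁) ((irrep η l₂ p₂).hom (irrep η l₃ p₃)) 0) :
    IsHomArray η l₁ p₁ l₂ l₃ fun m₁ m₂ m₃ =>
      (modSign l₁ l₂ l₃ m₁ m₂ m₃ : ℂ) * opCoeff T m₁ m₂ m₃ where
  range₁ hm _ _ := by simp [opCoeff, bvZ_of_notMem hm]
  range₂ hm _ _ := by simp [opCoeff, bvZ_of_notMem hm]
  range₃ hm _ _ := by simp [opCoeff, coord_of_notMem hm]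
  weight hm := by simp [opCoeff_weight hT hm]
  lower m₁ m₂ m₃ := by
    by_cases hm : m₃ = m₁ + m₂ + 1
    · have h := opCoeff_vp hT m₁ m₂ m₃
      have hq : (qpow η (-m₂ / 2) : ℂ) * qpow η (m₂ / 2) = 1 := by
        rw [neg_div]; exact_mod_cast qpow_neg_mul η (m₂ / 2)
      have hq' : (qpow η (m₂ / 2) : ℂ) * (qpow η (1 / 2) * qpow η (-m₃ / 2)) = qpow η (-m₁ / 2) := by
        rw [← Complex.ofReal_mul, ← Complex.ofReal_mul, qpow_mul, qpow_mul, hm]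
        push_cast
        ring_nf
      have s1 : modSign l₁ l₂ l₃ (m₁ + 1) m₂ m₃
          = modSign l₁ l₂ l₃ m₁ m₂ (m₃ - 1) * (-1) ^ ((l₃ : ℤ) - (m₃ - 1)) *
            (-1) ^ ((l₁ : ℤ) - m₁) := by
        simp only [modSign, ← zpow_add₀ (show (-1 : ℝ) ≠ 0 by norm_num)]
        exact neg_one_zpow_congr ⟨m₁ + m₂ - l₁ - l₂ - l₃, by rw [hm]; ring⟩
      have s2 : modSign l₁ l₂ l₃ m₁ (m₂ + 1) m₃
          = modSign l₁ l₂ l₃ m₁ m₂ (m₃ - 1) * (-1) ^ ((l₃ : ℤ) - (m₃ - 1)) *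
            (-1) ^ ((l₂ : ℤ) - m₂) := by
        simp only [modSign, ← zpow_add₀ (show (-1 : ℝ) ≠ 0 by norm_num)]
        exact neg_one_zpow_congr ⟨m₁ + m₂ - l₁ - l₂ - l₃, by rw [hm]; ring⟩
      have h3 := congrArg Complex.ofReal (neg_one_zpow_mul_self ((l₃ : ℤ) - (m₃ - 1)))
      rw [s1, s2]
      rw [raiseCoeff_eq, raiseCoeff_eq, raiseCoeff_eq, sub_add_cancel] at h
      simp only [Complex.ofReal_mul, Complex.ofReal_one] at h h3 ⊢
      generalize (((-1 : ℝ) ^ ((l₁ : ℤ) - m₁) : ℝ) : ℂ) = σ₁ at *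
      generalize (((-1 : ℝ) ^ ((l₂ : ℤ) - m₂) : ℝ) : ℂ) = σ₂ at *
      generalize (((-1 : ℝ) ^ ((l₃ : ℤ) - (m₃ - 1)) : ℝ) : ℂ) = σ₃ at *
      generalize (modSign l₁ l₂ l₃ m₁ m₂ (m₃ - 1) : ℂ) = s
      rw [← hq']
      linear_combination (-(s * σ₃ * qpow η (m₂ / 2))) * h
        - s * lowerCoeff η l₃ m₃ * opCoeff T m₁ m₂ (m₃ - 1) * (h3 + σ₃ * σ₃ * hq)
    · rw [opCoeff_weight hT (by omega), opCoeff_weight hT (by omega),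
        opCoeff_weight hT (by omega)]
      simp
  raise m₁ m₂ m₃ := by
    by_cases hm : m₃ = m₁ + m₂ - 1
    · have h := opCoeff_vm hT m₁ m₂ m₃
      have hq : (qpow η (-m₂ / 2) : ℂ) * qpow η (m₂ / 2) = 1 := by
        rw [neg_div]; exact_mod_cast qpow_neg_mul η (m₂ / 2)
      have hq' : (qpow η (m₂ / 2) : ℂ) * (qpow η (-1 / 2) * qpow η (-m₃ / 2))
          = qpow η (-m₁ / 2) := by
        rw [← Complex.ofReal_mul, ← Complex.ofReal_mul, qpow_mul, qpow_mul, hm]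
        push_cast
        ring_nf
      have s1 : modSign l₁ l₂ l₃ (m₁ - 1) m₂ m₃ * (-1) ^ ((l₁ : ℤ) - (m₁ - 1))
          = modSign l₁ l₂ l₃ m₁ m₂ (m₃ + 1) * (-1) ^ ((l₃ : ℤ) - m₃) := by
        simp only [modSign, ← zpow_add₀ (show (-1 : ℝ) ≠ 0 by norm_num)]
        exact neg_one_zpow_congr ⟨l₁ + l₂, by rw [hm]; ring⟩
      have s2 : modSign l₁ l₂ l₃ m₁ (m₂ - 1) m₃ * (-1) ^ ((l₂ : ℤ) - (m₂ - 1))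
          = modSign l₁ l₂ l₃ m₁ m₂ (m₃ + 1) * (-1) ^ ((l₃ : ℤ) - m₃) := by
        simp only [modSign, ← zpow_add₀ (show (-1 : ℝ) ≠ 0 by norm_num)]
        exact neg_one_zpow_congr ⟨l₁ + l₂, by rw [hm]; ring⟩
      replace s1 := congrArg Complex.ofReal s1
      replace s2 := congrArg Complex.ofReal s2
      rw [raiseCoeff_eq, raiseCoeff_eq, raiseCoeff_eq, sub_add_cancel, sub_add_cancel]
      simp only [Complex.ofReal_mul] at s1 s2 ⊢
      generalize (((-1 : ℝ) ^ ((l₁ : ℤ) - (m₁ - 1)) : ℝ) : ℂ) = σ₁ at *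
      generalize (((-1 : ℝ) ^ ((l₂ : ℤ) - (m₂ - 1)) : ℝ) : ℂ) = σ₂ at *
      generalize (((-1 : ℝ) ^ ((l₃ : ℤ) - m₃) : ℝ) : ℂ) = σ₃ at *
      generalize (modSign l₁ l₂ l₃ m₁ m₂ (m₃ + 1) : ℂ) = s at *
      rw [← hq']
      linear_combination (-(s * σ₃ * qpow η (m₂ / 2))) * h
        - s * σ₃ * lowerCoeff η l₃ (m₃ + 1) * opCoeff T m₁ m₂ (m₃ + 1) * hq
        - qpow η (m₂ / 2) * lowerCoeff η l₁ m₁ * opCoeff T (m₁ - 1) m₂ m₃ * s1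
        - sgn ((l₁ : ZMod 2) - (m₁ : ZMod 2) + p₁) * (qpow η (m₂ / 2) * (qpow η (-1 / 2) *
            qpow η (-m₃ / 2))) * lowerCoeff η l₂ m₂ * opCoeff T m₁ (m₂ - 1) m₃ * s2
    · rw [opCoeff_weight hT (by omega), opCoeff_weight hT (by omega),
        opCoeff_weight hT (by omega)]
      simp

end TensorOperators

/-! ### Existence of Clebsch-Gordan coefficients and the Wigner-Eckart theorem -/

/-- A nonzero array can be normalized to Clebsch-Gordan coefficients. -/
theorem exists_isClebschGordan {η : ℝ} (hη : η ≠ 0) {l₁ l₂ l₃ : ℕ} {p₁ p₂ p₃ : ZMod 2}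
    (hp : p₃ = p₁ + p₂ + (l₁ + l₂ + l₃ : ℕ)) {c : ℤ → ℤ → ℤ → ℂ}
    (h : IsHomArray η l₁ p₁ l₂ l₃ c) (h0 : c l₁ (l₃ - l₁) l₃ ≠ 0) :
    ∃ c', IsClebschGordan η l₁ p₁ l₂ p₂ l₃ p₃ c' := by
  obtain ⟨r, hr, hr0⟩ : ∃ r : ℤ → ℤ → ℤ → ℝ,
      (IsHomArray η l₁ p₁ l₂ l₃ fun m₁ m₂ m₃ => (r m₁ m₂ m₃ : ℂ)) ∧ r l₁ (l₃ - l₁) l₃ = 1 :=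
    ⟨fun m₁ m₂ m₃ => ((c l₁ (l₃ - l₁) l₃)⁻¹ * c m₁ m₂ m₃).re, (h.smul _).re, by
      simp only [inv_mul_cancel₀ h0, Complex.one_re]⟩
  obtain ⟨S, hS⟩ : ∃ S, ∑ m₁ : Wt l₁, ∑ m₂ : Wt l₂,
    (-1 : ℝ) ^ (((l₁ : ℤ) - m₁) * ((l₂ : ℤ) - m₂)) * r m₁ m₂ l₃ ^ 2 = S := ⟨_, rfl⟩
  have hpos : 0 < S := hS ▸ hr.sum_sq_pos hη (by rw [hr0]; exact one_ne_zero)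
  have hr' : IsHomArray η l₁ p₁ l₂ l₃ fun m₁ m₂ m₃ => (((√S)⁻¹ * r m₁ m₂ m₃ : ℝ) : ℂ) := by
    simpa only [Complex.ofReal_mul] using hr.smul ((√S)⁻¹ : ℝ)
  refine ⟨fun m₁ m₂ m₃ => (√S)⁻¹ * r m₁ m₂ m₃,
    linearCombination_mem_intertwiners (r := fun m₁ m₂ m₃ => (√S)⁻¹ * r m₁ m₂ m₃) hp hr', ?_, ?_⟩
  · simp only [Wt.top, mul_pow, mul_left_comm _ ((√S)⁻¹ ^ 2), ← Finset.mul_sum]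
    rw [hS, inv_pow, Real.sq_sqrt hpos.le, inv_mul_cancel₀ hpos.ne']
  · intro m₂ hm
    have : (m₂ : ℤ) = l₃ - l₁ := by omega
    simp only [Wt.top, this, hr0]
    positivity

end QuantumOsp

end

theorem theorem1 (η : ℝ) (hη : η ≠ 0) (l₁ l₂ l₃ : ℕ) (p₁ p₂ p₃ : ZMod 2)
    (hp : p₃ = p₁ + p₂ + (l₁ + l₂ + l₃ : ℕ))
    (T : QuantumOsp.Vsp l₁ →ₗ[ℂ] QuantumOsp.Vsp l₂ →ₗ[ℂ] QuantumOsp.Vsp l₃)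
    (hT : T ∈ QuantumOsp.tensorOperators (QuantumOsp.irrep η l₁ p₁) (QuantumOsp.irrep η l₂ p₂)
      (QuantumOsp.irrep η l₃ p₃)) :
    (∃ α : ℂ, ∀ (m₁ : QuantumOsp.Wt l₁) (m₂ : QuantumOsp.Wt l₂) (m₃ : QuantumOsp.Wt l₃),
      LinearMap.toMatrix' (T (QuantumOsp.bv m₁)) m₃ m₂
        = α * (QuantumOsp.modClebschGordan η l₁ p₁ l₂ p₂ l₃ p₃ m₁ m₂ m₃ : ℂ)) ∧
    T ∈ QuantumOsp.evenTensorOperators (QuantumOsp.irrep η l₁ p₁) (QuantumOsp.irrep η l₂ p₂)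
      (QuantumOsp.irrep η l₃ p₃) := by
  open QuantumOsp in
  -- The odd part of `T` vanishes.
  have heven : T ∈ evenTensorOperators (irrep η l₁ p₁) (irrep η l₂ p₂) (irrep η l₃ p₃) := by
    obtain ⟨T₀, hT₀, T₁, hT₁, rfl⟩ := Submodule.mem_sup.1 hT
    rw [odd_tensorOperator_eq_zero hp hT₁, add_zero]
    exact hT₀
  refine ⟨?_, heven⟩
  have hc := isHomArray_opCoeff heven
  set c : ℤ → ℤ → ℤ → ℂ := fun m₁ m₂ m₃ =>
    (modSign l₁ l₂ l₃ m₁ m₂ m₃ : ℂ) * opCoeff T m₁ m₂ m₃ with hc_def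
  have hopc (m₁ m₂ m₃ : ℤ) : opCoeff T m₁ m₂ m₃ = modSign l₁ l₂ l₃ m₁ m₂ m₃ * c m₁ m₂ m₃ := by
    rw [hc_def, ← mul_assoc, ← Complex.ofReal_mul, modSign_mul_self, Complex.ofReal_one, one_mul]
  by_cases h0 : c l₁ (l₃ - l₁) l₃ = 0
  · -- In this case `T = 0`.
    refine ⟨0, fun m₁ m₂ m₃ => ?_⟩
    rw [← opCoeff_coe, hopc, hc.eq_zero hη h0, mul_zero, zero_mul]
  · have hex := exists_isClebschGordan (p₂ := p₂) hη hp hc h0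
    have hcg := hex.choose_spec
    set c' := hex.choose with hc'_def
    have hc' := isHomArray_of_mem_intertwiners hcg.hom
    have hval (m₁ : Wt l₁) (m₂ : Wt l₂) (m₃ : Wt l₃) :
        tcoord l₁ l₂ m₁ m₂ (Fintype.linearCombination ℂ (reducedVec c') (bvZ l₃ m₃))
          = c' m₁ m₂ m₃ := by
      rw [bvZ_coe, linearCombination_bv, tcoord_reducedVec]
    have hrange : (l₃ : ℤ) - l₁ ∈ Finset.Icc (-(l₂ : ℤ)) l₂ := by
      by_contra hm
      exact h0 (hc.range₂ hm _ _)
    have htop : (c' (Wt.top l₁) ⟨l₃ - l₁, hrange⟩ (Wt.top l₃) : ℂ) ≠ 0 :=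
      Complex.ofReal_ne_zero.2 (hcg.phase _ (by simp)).ne'
    -- This multiple of `c'` has the same determining coefficient as `c`, hence equals `c`.
    refine ⟨c l₁ (l₃ - l₁) l₃ / c' (Wt.top l₁) ⟨l₃ - l₁, hrange⟩ (Wt.top l₃), fun m₁ m₂ m₃ => ?_⟩
    have hz := (hc.sub (hc'.smul
      (c l₁ (l₃ - l₁) l₃ / c' (Wt.top l₁) ⟨l₃ - l₁, hrange⟩ (Wt.top l₃)))).eq_zero hη (by
        have := hval (Wt.top l₁) ⟨l₃ - l₁, hrange⟩ (Wt.top l₃)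
        simp only [Wt.top] at this htop ⊢
        rw [this, div_mul_cancel₀ _ htop, sub_self]) m₁ m₂ m₃
    rw [hval, sub_eq_zero] at hz
    rw [← opCoeff_coe, hopc, hz, modClebschGordan, clebschGordan, dif_pos hex, ← hc'_def, modSign]
    push_cast
    ring
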